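/- Let $(M^n,g)$ be a Hermitian manifold: a complex manifold of complex dimension $n$ with a smooth Riemannian metric $g=\langle\cdot,\cdot\rangle$ such that $\langle Jx,Jy\rangle=\langle x,y\rangle$, where $J$ is the complex structure. Let $\nabla$ be its Levi-Civita connection; let $\nabla^c$ be its Chern connection (the connection with $\nabla^c g=0$, $\nabla^c J=0$ whose torsion has no $(1,1)$-part); and let $\nabla^b$ be its Bismut connection (the connection with $\nabla^b g=0$, $\nabla^b J=0$ and totally skew-symmetric torsion). For real numbers $r,s$ put $$D=D^r_s=(1-s)\Big(\tfrac{1+r}{2}\nabla^c+\tfrac{1-r}{2}\nabla^b\Big)+s\nabla ,\qquad t=\tfrac12(1-r+rs).$$ For a connection $D$ put $T^D(x,y)=D_xy-D_yx-[x,y]$ and $R^D_{xy}z=D_xD_yz-D_yD_xz-D_{[x,y]}z$; extend these, the metric and the connections $\mathbb C$-linearly in every argument to complex vector fields. Let $e=\{e_1,\dots,e_n\}$ be a local unitary frame, that is, smooth complex vector fields of type $(1,0)$ on an open set $U\subseteq M$ with $\langle e_i,\overline{e}_j\rangle=\delta_{ij}$. Write $R^D_{i\bar jk\bar\ell}=\langle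 R^D_{e_i\overline{e}_j}e_k,\overline{e}_\ell\rangle$, and write $R^c$, $R^b$ for the curvatures of $\nabla^c$, $\nabla^b$. Let $T=T^{\nabla^c}$ be the Chern torsion, $T(e_i,e_k)=\sum_jT^j_{ik}e_j$, and let $T^{\ell}_{ik;\bar j}$ be the coefficient of $e_\ell$ in $(\nabla^b_{\overline{e}_j}T)(e_i,e_k)$. For indices $i,j,k,\ell$ put $$w=\sum_qT^q_{ik}\overline{T^q_{j\ell}},\quad v^j_i=\sum_qT^j_{iq}\overline{T^k_{\ell q}},\quad v^\ell_i=\sum_qT^\ell_{iq}\overline{T^k_{jq}},\quad v^j_k=\sum_qT^j_{kq}\overline{T^i_{\ell q}},\quad v^\ell_k=\sum_qT^\ell_{kq}\overline{T^i_{jq}} .$$ For a quantity $F_{i\bar jk\bar\ell}$ let $\widehat F_{i\bar jk\bar\ell}=\frac14\big(F_{i\bar jk\bar\ell}+F_{k\bar ji\bar\ell}+F_{i\bar\ell k\bar j}+F_{k\bar\ell i\bar j}\big)$, and put $\widehat v=\frac14\big(v^j_i+v^j_k+v^\ell_i+v^\ell_k\big)$, which is the symmetrization of $v^j_i$. Then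 at every point of $U$, for all $1\le i,j,k,\ell\le n$ and all real $r,s$ (in particular for all $(r,s)$ with $s\neq1$ or $(r,s)=(0,1)$), $$R^D_{i\bar jk\bar\ell}=R^c_{i\bar jk\bar\ell}+t\Big(T^\ell_{ik;\bar j}+\overline{T^k_{j\ell;\bar i}}\Big)+(t^2-2t)(w-v^\ell_i)-t\,(v^j_i+v^\ell_k)-\frac{s^2}{4}v^j_k ,$$ and $$\widehat R^D_{i\bar jk\bar\ell}=\widehat R^c_{i\bar jk\bar\ell}-\Big(t^2+\frac{s^2}{4}\Big)\widehat v=\widehat R^b_{i\bar jk\bar\ell}+\Big(1-t^2-\frac{s^2}{4}\Big)\widehat v .$$ -/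

import Mathlib

open Bundle
open scoped Manifold ContDiff

noncomputable section

/-! ### Complex manifolds as real manifolds -/

instance FiniteDimensional.completeSpaceOfComplex {E : Type*} [NormedAddCommGroup E]
    [NormedSpace ℂ E] [FiniteDimensional ℂ E] : CompleteSpace E :=
  FiniteDimensional.complete ℂ E

/-- A complex manifold (holomorphic transition maps) is a smooth, indeed real analytic, real
manifold. -/
instance IsManifold.realOfComplex {E : Type*} [NormedAddCommGroup E] [NormedSpace ℂ E]
    {M : Type*} [TopologicalSpace M] [ChartedSpace E M] [IsManifold 𝓘(ℂ, E) ω M] :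
    IsManifold 𝓘(ℝ, E) ω M := by
  refine isManifold_of_contDiffOn 𝓘(ℝ, E) ω M fun e e' he he' => ?_
  have h := (contDiffGroupoid ω 𝓘(ℂ, E)).compatible he he'
  rw [contDiffGroupoid, mem_groupoid_of_pregroupoid] at h
  exact ContDiffOn.restrict_scalars ℝ h.1

namespace Hermitian

/-- The real tangent space at `x` of a manifold with charts in the complex vector space `E`. -/
abbrev RTan (E : Type*) [NormedAddCommGroup E] [NormedSpace ℂ E] {M : Type*} [TopologicalSpace M]
    [ChartedSpace E M] (x : M) : Type _ :=
  TangentSpace 𝓘(ℝ, E) x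

/-- The complexified tangent space `T_x M ⊗ ℂ = T_x M ⊕ √-1 T_x M`:
the pair `(u, v)` stands for `u + √-1 v`. -/
abbrev CTan (E : Type*) [NormedAddCommGroup E] [NormedSpace ℂ E] {M : Type*} [TopologicalSpace M]
    [ChartedSpace E M] (x : M) : Type _ :=
  RTan E x × RTan E x

/-- Affine connections on `M`: covariant derivatives on the real tangent bundle.
`D Y x v` is the derivative of the vector field `Y` at `x` in the direction `v`. -/
abbrev Connection (E : Type*) [NormedAddCommGroup E] [NormedSpace ℂ E] (M : Type*)
    [TopologicalSpace M] [ChartedSpace E M] [IsManifold 𝓘(ℂ, E) ω M] : Type _ :=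
  CovariantDerivative 𝓘(ℝ, E) E (RTan E : M → Type _)

variable {E : Type*} [NormedAddCommGroup E] [NormedSpace ℂ E]
  {M : Type*} [TopologicalSpace M] [ChartedSpace E M]

/-- The almost complex structure `J` of `M`. The tangent space at `x` is the model space `E`, by
means of the preferred chart at `x`, and `J` is multiplication by `√-1`; since transition maps are
holomorphic, all charts around `x` give the same `J`. -/
def J (x : M) : RTan E x →L[ℝ] RTan E x :=
  (Complex.I • ContinuousLinearMap.id ℝ E : E →L[ℝ] E)

/-- Complex conjugation on the complexified tangent space. -/
def conj {x : M} (z : CTan E x) : CTan E x := (z.1, -z.2)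

/-- Complex conjugation of complex vector fields. -/
def conjField (Z : Π x : M, CTan E x) : Π x : M, CTan E x := fun x => conj (Z x)

/-- `z` is of type `(1,0)`: `z = u - √-1 J u` for a real tangent vector `u`. -/
def IsType10 {x : M} (z : CTan E x) : Prop := z.2 = -J x z.1

/-- Smoothness of a complex vector field on a set. -/
def SmoothOn [IsManifold 𝓘(ℂ, E) ω M] (Z : Π x : M, CTan E x) (U : Set M) : Prop :=
  ContMDiffOn 𝓘(ℝ, E) 𝓘(ℝ, E).tangent ∞
      (fun x => (⟨x, (Z x).1⟩ : TangentBundle 𝓘(ℝ, E) M)) U ∧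
    ContMDiffOn 𝓘(ℝ, E) 𝓘(ℝ, E).tangent ∞
      (fun x => (⟨x, (Z x).2⟩ : TangentBundle 𝓘(ℝ, E) M)) U

/-- The `ℂ`-bilinear extension of the Lie bracket of vector fields. -/
def bracket (Z W : Π x : M, CTan E x) : Π x : M, CTan E x := fun x =>
  (VectorField.mlieBracket 𝓘(ℝ, E) (fun y => (Z y).1) (fun y => (W y).1) x
      - VectorField.mlieBracket 𝓘(ℝ, E) (fun y => (Z y).2) (fun y => (W y).2) x,
    VectorField.mlieBracket 𝓘(ℝ, E) (fun y => (Z y).1) (fun y => (W y).2) x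
      + VectorField.mlieBracket 𝓘(ℝ, E) (fun y => (Z y).2) (fun y => (W y).1) x)

section connection

variable [IsManifold 𝓘(ℂ, E) ω M]

/-- The `ℂ`-bilinear extension of a connection: `covD D Z W = D_Z W`. -/
def covD (D : Connection E M) (Z W : Π x : M, CTan E x) : Π x : M, CTan E x := fun x =>
  (D (fun y => (W y).1) x (Z x).1 - D (fun y => (W y).2) x (Z x).2,
    D (fun y => (W y).2) x (Z x).1 + D (fun y => (W y).1) x (Z x).2)

/-- The curvature `R_{ZW} V = D_Z D_W V - D_W D_Z V - D_{[Z,W]} V` on complex vector fields. -/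
def curvature (D : Connection E M) (Z W V : Π x : M, CTan E x) : Π x : M, CTan E x :=
  covD D Z (covD D W V) - covD D W (covD D Z V) - covD D (bracket Z W) V

variable [FiniteDimensional ℂ E]

/-- The `ℂ`-bilinear extension of the torsion tensor `D_x y - D_y x - [x, y]` of a connection. -/
def cTorsion (D : Connection E M) {x : M} (z w : CTan E x) : CTan E x :=
  (D.torsion x z.1 w.1 - D.torsion x z.2 w.2, D.torsion x z.1 w.2 + D.torsion x z.2 w.1)

/-- The torsion of a connection evaluated on complex vector fields. -/
def torsionField (D : Connection E M) (Z W : Π x : M, CTan E x) : Π x : M, CTan E x :=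
  fun x => cTorsion D (Z x) (W x)

/-- The covariant derivative, with respect to the connection `D`, of the torsion of the connection
`D'`: `(D_Z T)(V, W) = D_Z (T(V, W)) - T(D_Z V, W) - T(V, D_Z W)`. -/
def covDTorsion (D D' : Connection E M) (Z V W : Π x : M, CTan E x) : Π x : M, CTan E x :=
  covD D Z (torsionField D' V W) - torsionField D' (covD D Z V) W - torsionField D' V (covD D Z W)

/-- The connection preserves the almost complex structure: `D J = 0`. -/
def PreservesJ (D : Connection E M) : Prop :=
  ∀ (Y : Π x : M, RTan E x) (x : M),
    MDifferentiableAt 𝓘(ℝ, E) 𝓘(ℝ, E).tangent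
      (fun y => (⟨y, Y y⟩ : TangentBundle 𝓘(ℝ, E) M)) x →
    ∀ v : RTan E x, D (fun y => J y (Y y)) x v = J x (D Y x v)

end connection

section metric

variable [IsManifold 𝓘(ℂ, E) ω M]

variable (E M) in
/-- Smooth Riemannian metrics on `M`; `g.inner x u v` is `⟨u, v⟩` for `u`, `v` tangent at `x`. -/
abbrev Metric : Type _ :=
  ContMDiffRiemannianMetric 𝓘(ℝ, E) ∞ E (RTan E : M → Type _)

/-- The Riemannian metric is Hermitian: `⟨J u, J v⟩ = ⟨u, v⟩`. -/
def IsHermitianMetric (g : Metric E M) : Prop :=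
  ∀ (x : M) (u v : RTan E x), g.inner x (J x u) (J x v) = g.inner x u v

/-- The `ℂ`-bilinear extension of the Riemannian metric to the complexified tangent space. -/
def cInner (g : Metric E M) {x : M} (z w : CTan E x) : ℂ :=
  ⟨g.inner x z.1 w.1 - g.inner x z.2 w.2, g.inner x z.1 w.2 + g.inner x z.2 w.1⟩

/-- `e` is a smooth unitary frame of the bundle of `(1,0)` vectors over `U`. (A unitary family is
linearly independent, so it is a frame when its cardinality is the complex dimension of `M`.) -/
structure IsUnitaryFrameOn (g : Metric E M) {n : ℕ} (e : Fin n → Π x : M, CTan E x)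
    (U : Set M) : Prop where
  card : n = Module.finrank ℂ E
  smooth : ∀ i, SmoothOn (e i) U
  type10 : ∀ i, ∀ x ∈ U, IsType10 (e i x)
  unitary : ∀ i j, ∀ x ∈ U, cInner g (e i x) (conj (e j x)) = if i = j then 1 else 0

/-- Metric connections, `D g = 0`: `v ⟨Y, Z⟩ = ⟨D_v Y, Z⟩ + ⟨Y, D_v Z⟩` for vector fields `Y`, `Z`
differentiable at `x` and tangent vectors `v` at `x`. -/
def IsMetricConnection (g : Metric E M) (D : Connection E M) : Prop :=
  ∀ (Y Z : Π x : M, RTan E x) (x : M),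
    MDifferentiableAt 𝓘(ℝ, E) 𝓘(ℝ, E).tangent
      (fun y => (⟨y, Y y⟩ : TangentBundle 𝓘(ℝ, E) M)) x →
    MDifferentiableAt 𝓘(ℝ, E) 𝓘(ℝ, E).tangent
      (fun y => (⟨y, Z y⟩ : TangentBundle 𝓘(ℝ, E) M)) x →
    ∀ v : RTan E x, mvfderiv 𝓘(ℝ, E) (fun y => g.inner y (Y y) (Z y)) x v
      = g.inner x (D Y x v) (Z x) + g.inner x (Y x) (D Z x v)

variable [FiniteDimensional ℂ E]

/-- The Levi-Civita connection: the torsion-free metric connection. -/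
structure IsLeviCivita (g : Metric E M) (D : Connection E M) : Prop where
  metric : IsMetricConnection g D
  torsion_free : D.torsion = 0

/-- The Chern connection: the metric connection with `D J = 0` whose torsion has no
`(1,1)` part. -/
structure IsChern (g : Metric E M) (D : Connection E M) : Prop where
  metric : IsMetricConnection g D
  preservesJ : PreservesJ D
  torsion_11 : ∀ (x : M) (z w : CTan E x), IsType10 z → IsType10 w → cTorsion D z (conj w) = 0

/-- The Bismut connection: the metric connection with `D J = 0` whose torsion is totally
skew-symmetric. -/
structure IsBismut (g : Metric E M) (D : Connection E M) : Prop where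
  metric : IsMetricConnection g D
  preservesJ : PreservesJ D
  torsion_skew : ∀ (x : M) (u v w : RTan E x),
    g.inner x (D.torsion x u v) w = -g.inner x (D.torsion x u w) v

end metric

section components

variable [IsManifold 𝓘(ℂ, E) ω M]

/-- The Gauduchon connection `D^r = (1+r)/2 ∇^c + (1-r)/2 ∇^b`. -/
def gauduchon (chern bismut : Connection E M) (r : ℝ) : Connection E M :=
  chern.affineCombination bismut (fun _ => (1 + r) / 2)

/-- The canonical metric connection `D^r_s = (1-s) D^r + s ∇`. -/
def canonical (levi chern bismut : Connection E M) (r s : ℝ) : Connection E M :=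
  levi.affineCombination (gauduchon chern bismut r) (fun _ => s)

variable {n : ℕ}

/-- The curvature components `R^D_{i j̄ k l̄} = ⟨R^D(e_i, ē_j) e_k, ē_l⟩` at `x`. -/
def curvComp (g : Metric E M) (D : Connection E M) (e : Fin n → Π x : M, CTan E x)
    (x : M) (i j k l : Fin n) : ℂ :=
  cInner g (curvature D (e i) (conjField (e j)) (e k) x) (conj (e l x))

variable [FiniteDimensional ℂ E]

/-- The torsion components `T^j_{ik}`, the coefficient of `e_j` in `T(e_i, e_k)`, at `x`. -/
def torsComp (g : Metric E M) (D : Connection E M) (e : Fin n → Π x : M, CTan E x)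
    (x : M) (j i k : Fin n) : ℂ :=
  cInner g (cTorsion D (e i x) (e k x)) (conj (e j x))

/-- The components `T^l_{ik;j̄}`, the coefficient of `e_l` in `(D_{ē_j} T)(e_i, e_k)` at `x`, where
`T` is the torsion of `D'`. -/
def torsDerivComp (g : Metric E M) (D D' : Connection E M) (e : Fin n → Π x : M, CTan E x)
    (x : M) (l i k j : Fin n) : ℂ :=
  cInner g (covDTorsion D D' (conjField (e j)) (e i) (e k) x) (conj (e l x))

end components

/-- `w = ∑_r T^r_{ik} conj(T^r_{jl})`, where `T j i k` stands for `T^j_{ik}`. -/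
def wTerm {n : ℕ} (T : Fin n → Fin n → Fin n → ℂ) (i j k l : Fin n) : ℂ :=
  ∑ r, T r i k * (starRingEnd ℂ) (T r j l)

/-- `v^j_i = ∑_r T^j_{ir} conj(T^k_{lr})`, where `T j i k` stands for `T^j_{ik}`. The terms
`v^l_i`, `v^j_k`, `v^l_k` are obtained by exchanging `j` with `l`, `i` with `k`, and both. -/
def vTerm {n : ℕ} (T : Fin n → Fin n → Fin n → ℂ) (i j k l : Fin n) : ℂ :=
  ∑ r, T j i r * (starRingEnd ℂ) (T k l r)

/-- The symmetrization `(F_{ijkl} + F_{kjil} + F_{ilkj} + F_{klij}) / 4`. -/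
def symmetrize {n : ℕ} (F : Fin n → Fin n → Fin n → Fin n → ℂ) (i j k l : Fin n) : ℂ :=
  (F i j k l + F k j i l + F i l k j + F k l i j) / 4

end Hermitian

end

/-!
# Curvature of the canonical metric connections of a Hermitian manifold

All connections are compared with the Chern connection `∇^c` in the frame
`e_1, …, e_n, ē_1, …, ē_n` attached to a unitary frame `e`, through the coefficients
`⟨D_{E_A} E_B, E_C⟩` and `⟨T(E_A, E_B), E_C⟩`. For the Chern connection only `T(e_i, e_k)` and its
conjugate survive: the `(1,1)`-part vanishes by definition, and `T(e_i, e_k)` is of type `(1,0)`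
because `∇^c J = 0` and `J` is integrable (`nijenhuis`, proved in charts). The total skew-symmetry
of the Bismut torsion and the Koszul formula then express `∇^b` and `∇` by `∇^c` and `T`
(`IsBismut.connCoeff_inl`, `IsLeviCivita.connCoeff_eq`), and for `D = D^r_s`
* `⟨D_{e_i} e_k, ē_l⟩ = ⟨∇^c_{e_i} e_k, ē_l⟩ - t T^l_{ik}`,
* `⟨D_{ē_j} e_k, ē_l⟩ = ⟨∇^c_{ē_j} e_k, ē_l⟩ + t conj(T^k_{jl})`,
* `⟨D_{e_i} e_k, e_l⟩ = 0` and `⟨D_{ē_j} e_k, e_l⟩ = (s/2) T^j_{kl}`.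

Since `D` is metric, its curvature is a polynomial in these coefficients and their first derivatives
(`curvComp_eq`). The derivatives of `T` that appear in the curvature of `D` are completed to
`∇^b T` by the formula `torsDerivComp_eq`, and what remains is a termwise identity between finite
sums of products (`sum_quadratic_terms`). Symmetrization removes the part that is skew in `i`, `k`
or in `j`, `l`; the Bismut connection is the case `(r, s) = (-1, 0)`, where `t = 1`.

A connection here is not assumed to be smooth, and second covariant derivatives of a field mean
something only if the first ones are differentiable. This is a consequence of the characterizations
of `∇`, `∇^c` and `∇^b`: their coefficients are combinations of the structure functions
`⟨[E_A, E_B], E_C⟩` and their conjugates, and a vector field with differentiable coefficients in a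
unitary frame is differentiable (`IsUnitaryFrameOn.cDiffAt_of_cInner`).
-/

noncomputable section

namespace Hermitian

variable {E : Type*} [NormedAddCommGroup E] [NormedSpace ℂ E]
  {M : Type*} [TopologicalSpace M] [ChartedSpace E M]

/-! ### Complex vector fields: the metric, directional derivatives and differentiability -/

/-- Differentiability at `x` of a real vector field. -/
abbrev RDiffAt [IsManifold 𝓘(ℂ, E) ω M] (X : Π x : M, RTan E x) (x : M) : Prop :=
  MDifferentiableAt 𝓘(ℝ, E) 𝓘(ℝ, E).tangent (fun y => (⟨y, X y⟩ : TangentBundle 𝓘(ℝ, E) M)) x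

/-- Differentiability at `x` of a complex vector field, that is, of its real and imaginary
parts. -/
def CDiffAt [IsManifold 𝓘(ℂ, E) ω M] (Z : Π x : M, CTan E x) (x : M) : Prop :=
  RDiffAt (fun y => (Z y).1) x ∧ RDiffAt (fun y => (Z y).2) x

/-- The derivative `Z f` of a complex function along a complex vector field,
`ℂ`-linear in `Z`. -/
def dirDeriv (Z : Π x : M, CTan E x) (f : M → ℂ) (x : M) : ℂ :=
  mvfderiv 𝓘(ℝ, E) f x (Z x).1 + Complex.I * mvfderiv 𝓘(ℝ, E) f x (Z x).2

lemma mvfderiv_complex_mk {a b : M → ℝ} {x : M} (ha : MDifferentiableAt 𝓘(ℝ, E) 𝓘(ℝ, ℝ) a x)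
    (hb : MDifferentiableAt 𝓘(ℝ, E) 𝓘(ℝ, ℝ) b x) (v : RTan E x) :
    mvfderiv 𝓘(ℝ, E) (fun y => (⟨a y, b y⟩ : ℂ)) x v
      = ⟨mvfderiv 𝓘(ℝ, E) a x v, mvfderiv 𝓘(ℝ, E) b x v⟩ := by
  have h : (fun y => (⟨a y, b y⟩ : ℂ))
      = (a • fun _ => (1 : ℂ)) + (b • fun _ => Complex.I) := by
    funext y
    apply Complex.ext <;> simp
  have h1 : MDifferentiableAt 𝓘(ℝ, E) 𝓘(ℝ, ℂ) (fun _ : M => (1 : ℂ)) x := mdifferentiableAt_const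
  have h2 : MDifferentiableAt 𝓘(ℝ, E) 𝓘(ℝ, ℂ) (fun _ : M => Complex.I) x :=
    mdifferentiableAt_const
  rw [h, mvfderiv_add (ha.smul h1) (hb.smul h2), mvfderiv_smul ha h1, mvfderiv_smul hb h2]
  apply Complex.ext <;> simp [mvfderiv_const]

lemma mdifferentiableAt_complex_mk {a b : M → ℝ} {x : M}
    (ha : MDifferentiableAt 𝓘(ℝ, E) 𝓘(ℝ, ℝ) a x)
    (hb : MDifferentiableAt 𝓘(ℝ, E) 𝓘(ℝ, ℝ) b x) :
    MDifferentiableAt 𝓘(ℝ, E) 𝓘(ℝ, ℂ) (fun y => (⟨a y, b y⟩ : ℂ)) x := by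
  have h : (fun y => (⟨a y, b y⟩ : ℂ))
      = (a • fun _ => (1 : ℂ)) + (b • fun _ => Complex.I) := by
    funext y
    apply Complex.ext <;> simp
  rw [h]
  exact (ha.smul mdifferentiableAt_const).add (hb.smul mdifferentiableAt_const)

lemma mdifferentiableAt_clm_comp {f : M → ℂ} {x : M} {F : Type*} [NormedAddCommGroup F]
    [NormedSpace ℝ F] (L : ℂ →L[ℝ] F)
    (hf : MDifferentiableAt 𝓘(ℝ, E) 𝓘(ℝ, ℂ) f x) :
    MDifferentiableAt 𝓘(ℝ, E) 𝓘(ℝ, F) (fun y => L (f y)) x :=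
  (L.mdifferentiableAt (x := f x)).comp x hf

lemma dirDeriv_congr {Z : Π x : M, CTan E x} {f f' : M → ℂ} {x : M} (h : f =ᶠ[nhds x] f') :
    dirDeriv Z f x = dirDeriv Z f' x := by
  simp only [dirDeriv, mvfderiv, h.mfderiv_eq]
  rw [h.self_of_nhds]

lemma dirDeriv_add {Z : Π x : M, CTan E x} {f f' : M → ℂ} {x : M}
    (hf : MDifferentiableAt 𝓘(ℝ, E) 𝓘(ℝ, ℂ) f x) (hf' : MDifferentiableAt 𝓘(ℝ, E) 𝓘(ℝ, ℂ) f' x) :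
    dirDeriv Z (fun y => f y + f' y) x = dirDeriv Z f x + dirDeriv Z f' x := by
  simp only [dirDeriv, mvfderiv_fun_add hf hf', add_apply]
  ring

lemma dirDeriv_const (Z : Π x : M, CTan E x) (c : ℂ) (x : M) :
    dirDeriv Z (fun _ => c) x = 0 := by
  simp [dirDeriv, mvfderiv_const]

lemma mdifferentiableAt_const_mul {f : M → ℂ} {x : M} (c : ℂ)
    (hf : MDifferentiableAt 𝓘(ℝ, E) 𝓘(ℝ, ℂ) f x) :
    MDifferentiableAt 𝓘(ℝ, E) 𝓘(ℝ, ℂ) (fun y => c * f y) x :=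
  mdifferentiableAt_clm_comp ((ContinuousLinearMap.mul ℝ ℂ) c) hf

lemma mdifferentiableAt_star {f : M → ℂ} {x : M}
    (hf : MDifferentiableAt 𝓘(ℝ, E) 𝓘(ℝ, ℂ) f x) :
    MDifferentiableAt 𝓘(ℝ, E) 𝓘(ℝ, ℂ) (fun y => (starRingEnd ℂ) (f y)) x :=
  mdifferentiableAt_clm_comp (Complex.conjCLE : ℂ →L[ℝ] ℂ) hf

lemma mvfderiv_clm {f : M → ℂ} {x : M} (L : ℂ →L[ℝ] ℂ)
    (hf : MDifferentiableAt 𝓘(ℝ, E) 𝓘(ℝ, ℂ) f x) (v : RTan E x) :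
    mvfderiv 𝓘(ℝ, E) (fun y => L (f y)) x v = L (mvfderiv 𝓘(ℝ, E) f x v) := by
  have := mfderiv_comp_apply x (L.mdifferentiableAt (x := f x)) hf v
  rw [L.mfderiv_eq] at this
  exact this

lemma dirDeriv_const_mul {Z : Π x : M, CTan E x} {f : M → ℂ} {x : M} (c : ℂ)
    (hf : MDifferentiableAt 𝓘(ℝ, E) 𝓘(ℝ, ℂ) f x) :
    dirDeriv Z (fun y => c * f y) x = c * dirDeriv Z f x := by
  have := mvfderiv_clm ((ContinuousLinearMap.mul ℝ ℂ) c) hf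
  simp only [ContinuousLinearMap.mul_apply'] at this
  simp only [dirDeriv, this]
  ring

lemma dirDeriv_conjField {Z : Π x : M, CTan E x} {f : M → ℂ} {x : M}
    (hf : MDifferentiableAt 𝓘(ℝ, E) 𝓘(ℝ, ℂ) f x) :
    dirDeriv (conjField Z) (fun y => (starRingEnd ℂ) (f y)) x
      = (starRingEnd ℂ) (dirDeriv Z f x) := by
  have := mvfderiv_clm (Complex.conjCLE : ℂ →L[ℝ] ℂ) hf
  simp only [ContinuousLinearEquiv.coe_coe, Complex.conjCLE_apply] at this
  simp only [dirDeriv, this, conjField, conj, map_neg, map_add, map_mul, Complex.conj_I]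
  ring

@[simp] lemma conj_conj {x : M} (z : CTan E x) : conj (conj z) = z := by
  simp [conj]

section metric

variable [IsManifold 𝓘(ℂ, E) ω M] (g : Metric E M)

lemma cInner_comm {x : M} (z w : CTan E x) : cInner g z w = cInner g w z := by
  simp only [cInner, g.symm x z.1, g.symm x z.2]
  rw [add_comm]

lemma cInner_conj {x : M} (z w : CTan E x) :
    cInner g (conj z) (conj w) = (starRingEnd ℂ) (cInner g z w) := by
  apply Complex.ext <;> simp [cInner, conj]
  ring

lemma cInner_sub_left {x : M} (z z' w : CTan E x) :
    cInner g (z - z') w = cInner g z w - cInner g z' w := by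
  apply Complex.ext <;> simp [cInner] <;> ring

lemma cInner_neg_left {x : M} (z w : CTan E x) : cInner g (-z) w = -cInner g z w := by
  apply Complex.ext <;> simp [cInner] <;> ring

lemma mdifferentiableAt_inner {X Y : Π x : M, RTan E x} {x : M} (hX : RDiffAt X x)
    (hY : RDiffAt Y x) :
    MDifferentiableAt 𝓘(ℝ, E) 𝓘(ℝ, ℝ) (fun y => g.inner y (X y) (Y y)) x := by
  have hg := (g.contMDiff x).mdifferentiableAt (by simp)
  have := MDifferentiableAt.clm_bundle_apply₂ (F₁ := E) (F₂ := E) (E₁ := (RTan E : M → Type _))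
    (E₂ := (RTan E : M → Type _)) (F₃ := ℝ) (E₃ := fun _ => ℝ) (b := fun y => y)
    (IM := 𝓘(ℝ, E)) (IB := 𝓘(ℝ, E)) (ψ := g.inner) hg hX hY
  rw [mdifferentiableAt_section] at this
  exact this

lemma mdifferentiableAt_cInner {Z W : Π x : M, CTan E x} {x : M} (hZ : CDiffAt Z x)
    (hW : CDiffAt W x) :
    MDifferentiableAt 𝓘(ℝ, E) 𝓘(ℝ, ℂ) (fun y => cInner g (Z y) (W y)) x :=
  mdifferentiableAt_complex_mk
    ((mdifferentiableAt_inner g hZ.1 hW.1).sub (mdifferentiableAt_inner g hZ.2 hW.2))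
    ((mdifferentiableAt_inner g hZ.1 hW.2).add (mdifferentiableAt_inner g hZ.2 hW.1))

/-- The `ℂ`-bilinear extension of `D g = 0`. -/
lemma IsMetricConnection.dirDeriv_cInner {D : Connection E M} (hD : IsMetricConnection g D)
    (Z : Π x : M, CTan E x) {V W : Π x : M, CTan E x} {x : M} (hV : CDiffAt V x)
    (hW : CDiffAt W x) :
    dirDeriv Z (fun y => cInner g (V y) (W y)) x
      = cInner g (covD D Z V x) (W x) + cInner g (V x) (covD D Z W x) := by
  have h11 := mdifferentiableAt_inner g hV.1 hW.1
  have h22 := mdifferentiableAt_inner g hV.2 hW.2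
  have h12 := mdifferentiableAt_inner g hV.1 hW.2
  have h21 := mdifferentiableAt_inner g hV.2 hW.1
  have key (v : RTan E x) := mvfderiv_complex_mk (h11.sub h22) (h12.add h21) v
  have h (v : RTan E x) : mvfderiv 𝓘(ℝ, E) (fun y => cInner g (V y) (W y)) x v = _ := key v
  simp only [dirDeriv, h, mvfderiv_sub h11 h22, mvfderiv_add h12 h21, sub_apply,
    add_apply, hD _ _ x hV.1 hW.1, hD _ _ x hV.2 hW.2, hD _ _ x hV.1 hW.2,
    hD _ _ x hV.2 hW.1]
  apply Complex.ext <;> simp [cInner, covD] <;> ring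

end metric

/-! ### Integrability of the complex structure -/

section integrability

variable [IsManifold 𝓘(ℂ, E) ω M]

/-- Transition maps between charts are holomorphic. -/
lemma differentiableAt_transition (x y : M) {z : E} (hz : z ∈ (chartAt E x).target)
    (hy : (chartAt E x).symm z ∈ (chartAt E y).source) :
    DifferentiableAt ℂ (chartAt E y ∘ (chartAt E x).symm) z := by
  have h := (contDiffGroupoid ω 𝓘(ℂ, E)).compatible (chart_mem_atlas E x) (chart_mem_atlas E y)
  rw [contDiffGroupoid, mem_groupoid_of_pregroupoid] at h
  have h1 : ContDiffOn ℂ ω (𝓘(ℂ, E) ∘ ((chartAt E x).symm ≫ₕ chartAt E y) ∘ 𝓘(ℂ, E).symm)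
    (𝓘(ℂ, E).symm ⁻¹' ((chartAt E x).symm ≫ₕ chartAt E y).source ∩ Set.range 𝓘(ℂ, E)) := h.1
  simp only [modelWithCornersSelf_coe, modelWithCornersSelf_coe_symm, Set.range_id, Set.inter_univ,
    Set.preimage_id, Function.id_comp, Function.comp_id] at h1
  refine (h1.differentiableOn (by simp)).differentiableAt
    (((chartAt E x).symm ≫ₕ chartAt E y).open_source.mem_nhds ?_)
  simp [hz, hy]

/-- The differential of the inverse of a chart is `ℂ`-linear. -/
lemma mfderivWithin_extChartAt_symm_J (x : M) {z : E}
    (hz : z ∈ (extChartAt 𝓘(ℝ, E) x).target) (v : RTan E z) :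
    mfderivWithin 𝓘(ℝ, E) 𝓘(ℝ, E) (extChartAt 𝓘(ℝ, E) x).symm (Set.range 𝓘(ℝ, E)) z (J z v)
      = J _ (mfderivWithin 𝓘(ℝ, E) 𝓘(ℝ, E) (extChartAt 𝓘(ℝ, E) x).symm
        (Set.range 𝓘(ℝ, E)) z v) := by
  have hd := (mdifferentiableWithinAt_extChartAt_symm hz).hasMFDerivWithinAt
  have h := differentiableAt_transition x ((chartAt E x).symm z) (z := z) (by simpa using hz)
    (by simp)
  have h2 := hd.2
  have hw : (writtenInExtChartAt 𝓘(ℝ, E) 𝓘(ℝ, E) z (extChartAt 𝓘(ℝ, E) x).symm)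
      = (chartAt E ((chartAt E x).symm z) ∘ (chartAt E x).symm) := by
    ext w; simp [writtenInExtChartAt, chartAt_self_eq]
  simp only [hw, modelWithCornersSelf_coe, Set.range_id, Set.preimage_univ, Set.inter_univ] at h2
  have h3 := HasFDerivAt.unique (𝕜 := ℝ) (E := E) (F := E) (hasFDerivWithinAt_univ.1 h2)
    (h.hasFDerivAt.restrictScalars ℝ)
  have h4 (w : E) : mfderivWithin 𝓘(ℝ, E) 𝓘(ℝ, E) (extChartAt 𝓘(ℝ, E) x).symm
      (Set.range 𝓘(ℝ, E)) z w = fderiv ℂ (chartAt E ((chartAt E x).symm z)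
        ∘ (chartAt E x).symm) z w := by
    simp only [modelWithCornersSelf_coe, Set.range_id]
    exact congrArg (fun L : E →L[ℝ] E => L w) h3
  have h5 (w : E) := map_smul (fderiv ℂ (chartAt E ((chartAt E x).symm z) ∘ (chartAt E x).symm) z)
    Complex.I w
  exact (h4 _).trans ((h5 v).trans (congrArg (fun w : E => Complex.I • w) (h4 v)).symm)

/-- A vector field `X` on `M`, read in the preferred chart at `x`. -/
def inChart (x : M) (X : Π x : M, RTan E x) : E → E :=
  VectorField.mpullbackWithin 𝓘(ℝ, E) 𝓘(ℝ, E) (extChartAt 𝓘(ℝ, E) x).symm X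
    (Set.range 𝓘(ℝ, E))

lemma inChart_J (x : M) (X : Π x : M, RTan E x) {z : E}
    (hz : z ∈ (extChartAt 𝓘(ℝ, E) x).target) :
    inChart x (fun y => J y (X y)) z = Complex.I • inChart x X z := by
  have hi := isInvertible_mfderivWithin_extChartAt_symm hz
  have h := mfderivWithin_extChartAt_symm_J x hz
    ((mfderivWithin 𝓘(ℝ, E) 𝓘(ℝ, E) (extChartAt 𝓘(ℝ, E) x).symm
        (Set.range 𝓘(ℝ, E)) z).inverse (X ((extChartAt 𝓘(ℝ, E) x).symm z)))
  rw [hi.self_apply_inverse] at h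
  exact (congrArg _ h.symm).trans (hi.inverse_apply_self _)

lemma differentiableAt_inChart [CompleteSpace E] {x : M} {X : Π x : M, RTan E x}
    (hX : RDiffAt X x) : DifferentiableAt ℝ (inChart x X) (extChartAt 𝓘(ℝ, E) x x) := by
  have h := hX.mdifferentiableWithinAt (s := Set.univ)
    |>.differentiableWithinAt_mpullbackWithin_vectorField
  simp only [modelWithCornersSelf_coe, Set.range_id, Set.preimage_univ, Set.inter_univ] at h
  simpa only [inChart, modelWithCornersSelf_coe, Set.range_id] using
    differentiableWithinAt_univ.1 h

lemma mlieBracket_eq_inChart (X Y : Π x : M, RTan E x) (x : M) :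
    VectorField.mlieBracket 𝓘(ℝ, E) X Y x
      = (VectorField.lieBracket ℝ (inChart x X) (inChart x Y) (extChartAt 𝓘(ℝ, E) x x) : E) := by
  have h (w : E) : (ContinuousLinearMap.inverse (R := ℝ) (M := E) (M₂ := E)
      (mfderiv 𝓘(ℝ, E) 𝓘(ℝ, E) (extChartAt 𝓘(ℝ, E) x) x) : E →L[ℝ] E) w = w := by
    have h1 : mfderiv 𝓘(ℝ, E) 𝓘(ℝ, E) (extChartAt 𝓘(ℝ, E) x) x = ContinuousLinearMap.id ℝ E :=
      mfderiv_extChartAt_self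
    rw [h1, ContinuousLinearMap.inverse_id, ContinuousLinearMap.id_apply]
  rw [← VectorField.mlieBracketWithin_univ, VectorField.mlieBracketWithin_apply]
  refine (h _).trans ?_
  change VectorField.lieBracketWithin ℝ (inChart x X) (inChart x Y) _ _ = _
  simp only [Set.preimage_univ, Set.univ_inter, modelWithCornersSelf_coe, Set.range_id,
    VectorField.lieBracketWithin_univ]

/-- The Nijenhuis tensor of `J` vanishes: charts transport `J` to the multiplication by `√-1` of
`E`, which commutes with differentiation. -/
lemma nijenhuis [CompleteSpace E] {X Y : Π x : M, RTan E x} {x : M} (hX : RDiffAt X x)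
    (hY : RDiffAt Y x) :
    VectorField.mlieBracket 𝓘(ℝ, E) X (fun y => J y (Y y)) x
        + VectorField.mlieBracket 𝓘(ℝ, E) (fun y => J y (X y)) Y x
      = J x (VectorField.mlieBracket 𝓘(ℝ, E) X Y x
        - VectorField.mlieBracket 𝓘(ℝ, E) (fun y => J y (X y)) (fun y => J y (Y y)) x) := by
  have ht : (extChartAt 𝓘(ℝ, E) x).target ∈ nhds (extChartAt 𝓘(ℝ, E) x x) :=
    extChartAt_target_mem_nhds x
  have hJ (X : Π x : M, RTan E x) : inChart x (fun y => J y (X y))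
      =ᶠ[nhds (extChartAt 𝓘(ℝ, E) x x)] fun z => Complex.I • inChart x X z := by
    filter_upwards [ht] with z hz using inChart_J x X hz
  have hJd {X : Π x : M, RTan E x} (hX : RDiffAt X x) :
      fderiv ℝ (inChart x (fun y => J y (X y))) (extChartAt 𝓘(ℝ, E) x x)
        = Complex.I • fderiv ℝ (inChart x X) (extChartAt 𝓘(ℝ, E) x x) := by
    rw [(hJ X).fderiv_eq]
    exact fderiv_const_smul (differentiableAt_inChart hX) Complex.I
  simp only [mlieBracket_eq_inChart]
  change (_ + _ : E) = Complex.I • (_ - _ : E)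
  simp only [VectorField.lieBracket, hJd hX, hJd hY, (hJ X).self_of_nhds, (hJ Y).self_of_nhds,
    smul_apply, smul_sub, smul_smul, Complex.I_mul_I]
  module

end integrability

/-! ### Expansions in a unitary frame -/

lemma J_J {x : M} (u : RTan E x) : J x (J x u) = -u := by
  have h (v : E) : Complex.I • Complex.I • v = -v := by
    rw [smul_smul, Complex.I_mul_I, neg_one_smul]
  exact h u

/-- The frame `e_1, …, e_n, ē_1, …, ē_n` of the complexified tangent bundle: `frame e (inl i)` is
`e_i` and `frame e (inr j)` is `ē_j`, so that complex conjugation is `Sum.swap` on indices. -/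
def frame {n : ℕ} (e : Fin n → Π x : M, CTan E x) : Fin n ⊕ Fin n → Π x : M, CTan E x :=
  Sum.elim e (fun j => conjField (e j))

lemma conj_frame {n : ℕ} (e : Fin n → Π x : M, CTan E x) (A : Fin n ⊕ Fin n) (x : M) :
    conj (frame e A x) = frame e A.swap x := by
  rcases A with i | j <;> simp [frame, conjField]

lemma conjField_frame {n : ℕ} (e : Fin n → Π x : M, CTan E x) (A : Fin n ⊕ Fin n) :
    conjField (frame e A) = frame e A.swap :=
  funext fun x => conj_frame e A x

/-- The `ℂ`-linear extension to the complexified tangent space of an `ℝ`-linear map. -/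
def complexify {x : M} (φ : RTan E x →ₗ[ℝ] ℂ) (z : CTan E x) : ℂ := φ z.1 + Complex.I * φ z.2

section frame

variable [IsManifold 𝓘(ℂ, E) ω M] {g : Metric E M} {n : ℕ} {e : Fin n → Π x : M, CTan E x}
  {U : Set M} {x : M}

/-- Vectors of type `(1,0)` are isotropic for the `ℂ`-bilinear extension of a Hermitian metric. -/
lemma cInner_type10 (hg : IsHermitianMetric g) {z w : CTan E x} (hz : IsType10 z)
    (hw : IsType10 w) : cInner g z w = 0 := by
  have h1 := hg x z.1 w.1
  have h2 := hg x z.1 (J x w.1)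
  rw [J_J] at h2
  simp only [IsType10] at hz hw
  apply Complex.ext <;> simp [cInner, hz, hw, h1]
  simp at h2
  linarith

lemma IsUnitaryFrameOn.cInner_frame (hg : IsHermitianMetric g) (he : IsUnitaryFrameOn g e U)
    (hx : x ∈ U) (A B : Fin n ⊕ Fin n) :
    cInner g (frame e A x) (frame e B x) = if A = B.swap then 1 else 0 := by
  rcases A with i | i <;> rcases B with j | j
  · simpa [frame] using cInner_type10 hg (he.type10 i x hx) (he.type10 j x hx)
  · simpa [frame, conjField] using he.unitary i j x hx
  · rw [cInner_comm]
    simpa [frame, conjField, eq_comm] using he.unitary j i x hx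
  · simpa [frame, conjField, cInner_conj] using
      cInner_type10 hg (he.type10 i x hx) (he.type10 j x hx)

/-- The real and imaginary parts of a unitary frame are orthogonal vectors of square length `1/2`:
combine `⟨e_i, ē_j⟩ = δ_ij` with `⟨e_i, e_j⟩ = 0`. -/
lemma IsUnitaryFrameOn.inner_re_im (hg : IsHermitianMetric g) (he : IsUnitaryFrameOn g e U)
    (hx : x ∈ U) (i j : Fin n) :
    g.inner x (e i x).1 (e j x).1 = (if i = j then 1 / 2 else 0) ∧
    g.inner x (e i x).2 (e j x).2 = (if i = j then 1 / 2 else 0) ∧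
    g.inner x (e i x).1 (e j x).2 = 0 ∧ g.inner x (e i x).2 (e j x).1 = 0 := by
  have h1 := he.unitary i j x hx
  have h2 := cInner_type10 hg (he.type10 i x hx) (he.type10 j x hx)
  have a1 := congrArg Complex.re h1
  have a2 := congrArg Complex.im h1
  have a3 := congrArg Complex.re h2
  have a4 := congrArg Complex.im h2
  simp only [cInner, conj, map_neg, Complex.zero_re, Complex.zero_im] at a1 a2 a3 a4
  split_ifs at a1 a2 ⊢ <;> simp at a1 a2 <;> refine ⟨?_, ?_, ?_, ?_⟩ <;> linarith

/-- The real and imaginary parts of a unitary frame form an orthogonal basis of the real tangent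
space, of vectors of square length `1/2`. -/
lemma IsUnitaryFrameOn.real_expansion [FiniteDimensional ℂ E] (hg : IsHermitianMetric g)
    (he : IsUnitaryFrameOn g e U) (hx : x ∈ U) (X : RTan E x) :
    X = ∑ q, ((2 * g.inner x X (e q x).1) • (e q x).1
      + (2 * g.inner x X (e q x).2) • (e q x).2) := by
  set b : Fin n ⊕ Fin n → RTan E x := Sum.elim (fun q => (e q x).1) (fun q => (e q x).2) with hb
  have hbb (A B : Fin n ⊕ Fin n) : g.inner x (b A) (b B) = if A = B then 1 / 2 else 0 := by
    rcases A with i | i <;> rcases B with j | j <;>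
      simp [hb, he.inner_re_im hg hx i j]
  have hcoef (c : Fin n ⊕ Fin n → ℝ) (B : Fin n ⊕ Fin n) :
      2 * g.inner x (∑ A, c A • b A) (b B) = c B := by
    simp [-Fintype.sum_sum_type, hbb, mul_comm (c B)]
  have hli : LinearIndependent ℝ b := by
    rw [Fintype.linearIndependent_iff]
    intro c hc B
    rw [← hcoef c B, hc]
    simp
  have hcard : Fintype.card (Fin n ⊕ Fin n) = Module.finrank ℝ (RTan E x) := by
    have : Module.finrank ℝ (RTan E x) = 2 * Module.finrank ℂ E := finrank_real_of_complex E
    rw [this, ← he.card]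
    simp [two_mul]
  have hfin : FiniteDimensional ℝ (RTan E x) := FiniteDimensional.complexToReal E
  have hspan := hli.span_eq_top_of_card_eq_finrank' hcard
  have hX : X ∈ Submodule.span ℝ (Set.range b) := by rw [hspan]; trivial
  obtain ⟨c, rfl⟩ := (Submodule.mem_span_range_iff_exists_fun ℝ).1 hX
  have h1 (q : Fin n) := hcoef c (Sum.inl q)
  have h2 (q : Fin n) := hcoef c (Sum.inr q)
  simp only [hb, Sum.elim_inl, Sum.elim_inr] at h1 h2
  simp only [hb, h1, h2]
  rw [Fintype.sum_sum_type, Finset.sum_add_distrib]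
  rfl

/-- Expansion of a vector in a unitary frame, under a `ℂ`-linear functional: the coefficient of
`E_A` is `⟨z, conj E_A⟩`. -/
lemma IsUnitaryFrameOn.complexify_expansion [FiniteDimensional ℂ E] (hg : IsHermitianMetric g)
    (he : IsUnitaryFrameOn g e U) (hx : x ∈ U) (φ : RTan E x →ₗ[ℝ] ℂ) (z : CTan E x) :
    complexify φ z = ∑ A, cInner g z (frame e A.swap x) * complexify φ (frame e A x) := by
  have h1 := congrArg φ (he.real_expansion hg hx z.1)
  have h2 := congrArg φ (he.real_expansion hg hx z.2)
  rw [Fintype.sum_sum_type, ← Finset.sum_add_distrib, complexify, h1, h2, map_sum, map_sum,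
    Finset.mul_sum, ← Finset.sum_add_distrib]
  refine Finset.sum_congr rfl fun q _ => ?_
  simp only [Sum.swap_inl, Sum.swap_inr, frame, Sum.elim_inl, Sum.elim_inr, conjField, conj,
    complexify, cInner, map_add, map_smul, map_neg, Complex.real_smul, Complex.mk_eq_add_mul_I]
  push_cast
  ring_nf
  simp only [Complex.I_sq]
  ring

/-- Expansion of the metric in a unitary frame. -/
lemma IsUnitaryFrameOn.cInner_expansion [FiniteDimensional ℂ E] (hg : IsHermitianMetric g)
    (he : IsUnitaryFrameOn g e U) (hx : x ∈ U) (z w : CTan E x) :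
    cInner g z w = ∑ A, cInner g z (frame e A.swap x) * cInner g (frame e A x) w := by
  let φ : RTan E x →ₗ[ℝ] ℂ :=
    { toFun := fun u => g.inner x u w.1 + Complex.I * g.inner x u w.2
      map_add' := fun u v => by simp; ring
      map_smul' := fun c u => by simp; ring }
  have h (z : CTan E x) : complexify φ z = cInner g z w := by
    apply Complex.ext <;> simp [complexify, φ, cInner]
    ring
  simpa only [h] using he.complexify_expansion hg hx φ z

lemma IsUnitaryFrameOn.cDiffAt_frame (hU : IsOpen U) (he : IsUnitaryFrameOn g e U) (hx : x ∈ U)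
    (A : Fin n ⊕ Fin n) : CDiffAt (frame e A) x := by
  have h (i : Fin n) : CDiffAt (e i) x :=
    ⟨((he.smooth i).1.contMDiffAt (hU.mem_nhds hx)).mdifferentiableAt (by simp),
      ((he.smooth i).2.contMDiffAt (hU.mem_nhds hx)).mdifferentiableAt (by simp)⟩
  rcases A with i | j
  · exact h i
  · exact ⟨(h j).1, mdifferentiableAt_neg_section (E := (RTan E : M → Type _)) (h j).2⟩

/-- A complex vector field is differentiable when its components in a unitary frame are. -/
lemma IsUnitaryFrameOn.cDiffAt_of_cInner [FiniteDimensional ℂ E] (hg : IsHermitianMetric g)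
    (hU : IsOpen U) (he : IsUnitaryFrameOn g e U) (hx : x ∈ U) {Z : Π x : M, CTan E x}
    (hZ : ∀ A, MDifferentiableAt 𝓘(ℝ, E) 𝓘(ℝ, ℂ) (fun y => cInner g (Z y) (frame e A y)) x) :
    CDiffAt Z x := by
  -- The sum and the difference of the components along `e_q` and `ē_q` have as real and imaginary
  -- parts, up to sign, twice the inner products of `Re Z`, `Im Z` with `Re e_q`, `Im e_q`.
  have hre (q : Fin n) := mdifferentiableAt_clm_comp Complex.reCLM
    ((hZ (Sum.inl q)).add (hZ (Sum.inr q)))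
  have him (q : Fin n) := mdifferentiableAt_clm_comp Complex.imCLM
    ((hZ (Sum.inl q)).add (hZ (Sum.inr q)))
  have hre' (q : Fin n) := mdifferentiableAt_clm_comp Complex.reCLM
    ((hZ (Sum.inr q)).sub (hZ (Sum.inl q)))
  have him' (q : Fin n) := mdifferentiableAt_clm_comp Complex.imCLM
    ((hZ (Sum.inl q)).sub (hZ (Sum.inr q)))
  simp only [Complex.reCLM_apply, Complex.imCLM_apply, Pi.add_apply, Pi.sub_apply, frame,
    Sum.elim_inl, Sum.elim_inr, conjField, conj, cInner, Complex.add_re, Complex.add_im,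
    Complex.sub_re, Complex.sub_im, map_neg] at hre him hre' him'
  have key (X : Π x : M, RTan E x)
      (h1 : ∀ q, MDifferentiableAt 𝓘(ℝ, E) 𝓘(ℝ, ℝ) (fun y => 2 * g.inner y (X y) (e q y).1) x)
      (h2 : ∀ q, MDifferentiableAt 𝓘(ℝ, E) 𝓘(ℝ, ℝ) (fun y => 2 * g.inner y (X y) (e q y).2) x) :
      RDiffAt X x := by
    have h3 := MDifferentiableAt.sum_section (E := (RTan E : M → Type _)) (s := Finset.univ)
      fun q (_ : q ∈ Finset.univ) =>
      mdifferentiableAt_add_section ((h1 q).smul_section (he.cDiffAt_frame hU hx (Sum.inl q)).1)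
        ((h2 q).smul_section (he.cDiffAt_frame hU hx (Sum.inl q)).2)
    refine h3.congr_of_eventuallyEq ?_
    filter_upwards [hU.mem_nhds hx] with y hy
    exact congrArg (Bundle.TotalSpace.mk y) (he.real_expansion hg hy (X y))
  refine ⟨key _ (fun q => ?_) (fun q => ?_), key _ (fun q => ?_) (fun q => ?_)⟩
  · convert! hre q using 2; ring
  · convert! him' q using 2; ring
  · convert! him q using 2; ring
  · convert! hre' q using 2; ring

end frame

/-! ### Connection, bracket and torsion coefficients in a unitary frame -/

section coefficients

variable [IsManifold 𝓘(ℂ, E) ω M] {n : ℕ}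

/-- The connection coefficients `⟨D_{E_A} E_B, E_C⟩` in the frame `e_1, …, e_n, ē_1, …, ē_n`. -/
def connCoeff (g : Metric E M) (D : Connection E M) (e : Fin n → Π x : M, CTan E x)
    (A B C : Fin n ⊕ Fin n) (x : M) : ℂ :=
  cInner g (covD D (frame e A) (frame e B) x) (frame e C x)

/-- The structure functions `⟨[E_A, E_B], E_C⟩`. -/
def brCoeff (g : Metric E M) (e : Fin n → Π x : M, CTan E x)
    (A B C : Fin n ⊕ Fin n) (x : M) : ℂ :=
  cInner g (bracket (frame e A) (frame e B) x) (frame e C x)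

/-- The torsion coefficients `⟨T(E_A, E_B), E_C⟩`. -/
def torsCoeff [FiniteDimensional ℂ E] (g : Metric E M) (D : Connection E M)
    (e : Fin n → Π x : M, CTan E x) (A B C : Fin n ⊕ Fin n) (x : M) : ℂ :=
  cInner g (cTorsion D (frame e A x) (frame e B x)) (frame e C x)

lemma conn_neg (D : Connection E M) {Y : Π x : M, RTan E x} {x : M} (hY : RDiffAt Y x) :
    D (fun y => -Y y) x = -D Y x := by
  have h := D.isCovariantDerivativeOnUniv.smul_const (-1 : ℝ) hY
  simp only [neg_smul, one_smul] at h
  exact h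

lemma covD_conjField (D : Connection E M) (Z : Π x : M, CTan E x) {W : Π x : M, CTan E x} {x : M}
    (hW : CDiffAt W x) : covD D (conjField Z) (conjField W) x = conj (covD D Z W x) := by
  simp only [covD, conjField, conj, conn_neg D hW.2]
  ext <;> simp
  abel

/-- `D_X Y` at `x` depends only on the germ of `Y` at `x`. -/
lemma conn_congr (D : Connection E M) {Y Y' : Π x : M, RTan E x} {x : M} (hY : RDiffAt Y x)
    (h : ∀ᶠ y in nhds x, Y' y = Y y) : D Y' x = D Y x := by
  refine D.isCovariantDerivativeOnUniv.congr_of_eventuallyEq (hY.congr_of_eventuallyEq ?_) hY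
    Filter.univ_mem h
  filter_upwards [h] with y hy
  rw [hy]

/-- A connection preserving `J` preserves type `(1,0)`. -/
lemma isType10_covD {D : Connection E M} (hD : PreservesJ D) (Z : Π x : M, CTan E x)
    {W : Π x : M, CTan E x} {x : M} (hW : CDiffAt W x) (h10 : ∀ᶠ y in nhds x, IsType10 (W y)) :
    IsType10 (covD D Z W x) := by
  have h (v : RTan E x) : D (fun y => (W y).2) x v = -J x (D (fun y => (W y).1) x v) := by
    have h1 : D (fun y => -(W y).2) x = D (fun y => J y (W y).1) x := by
      refine (conn_congr D ?_ ?_).symm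
      · exact mdifferentiableAt_neg_section (E := (RTan E : M → Type _)) hW.2
      · filter_upwards [h10] with y hy
        rw [hy, neg_neg]
    rw [conn_neg D hW.2] at h1
    have h2 := congrArg (fun L => L v) h1
    simp only [hD _ x hW.1 v] at h2
    rw [← h2]
    simp
  simp only [IsType10, covD, h, map_sub, map_neg, J_J]
  abel

lemma mlieBracket_neg_left [CompleteSpace E] {X Y : Π x : M, RTan E x} {x : M}
    (hX : RDiffAt X x) :
    VectorField.mlieBracket 𝓘(ℝ, E) (fun y => -X y) Y x
      = -VectorField.mlieBracket 𝓘(ℝ, E) X Y x := by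
  have h := VectorField.mlieBracket_const_smul_left (c := (-1 : ℝ)) (W := Y) hX
  simp only [neg_smul, one_smul] at h
  exact h

lemma mlieBracket_neg_right [CompleteSpace E] {X Y : Π x : M, RTan E x} {x : M}
    (hY : RDiffAt Y x) :
    VectorField.mlieBracket 𝓘(ℝ, E) X (fun y => -Y y) x
      = -VectorField.mlieBracket 𝓘(ℝ, E) X Y x := by
  have h := VectorField.mlieBracket_const_smul_right (c := (-1 : ℝ)) (V := X) hY
  simp only [neg_smul, one_smul] at h
  exact h

/-- The bracket of vector fields of type `(1,0)` is of type `(1,0)`. -/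
lemma isType10_bracket [CompleteSpace E] {Z W : Π x : M, CTan E x} {x : M}
    (hZ : CDiffAt Z x) (hW : CDiffAt W x) (hZ10 : ∀ᶠ y in nhds x, IsType10 (Z y))
    (hW10 : ∀ᶠ y in nhds x, IsType10 (W y)) : IsType10 (bracket Z W x) := by
  have hZ' : (fun y => J y (Z y).1) =ᶠ[nhds x] fun y => -(Z y).2 := by
    filter_upwards [hZ10] with y hy
    rw [hy, neg_neg]
  have hW' : (fun y => J y (W y).1) =ᶠ[nhds x] fun y => -(W y).2 := by
    filter_upwards [hW10] with y hy
    rw [hy, neg_neg]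
  have hZn : RDiffAt (fun y => -(Z y).2) x :=
    mdifferentiableAt_neg_section (E := (RTan E : M → Type _)) hZ.2
  have h := nijenhuis hZ.1 hW.1
  have r : ∀ X : Π x : M, RTan E x, X =ᶠ[nhds x] X := fun X => Filter.EventuallyEq.rfl
  rw [(r _).mlieBracket_vectorField_eq hW', hZ'.mlieBracket_vectorField_eq (r _),
    hZ'.mlieBracket_vectorField_eq hW', mlieBracket_neg_right hW.2, mlieBracket_neg_left hZ.2,
    mlieBracket_neg_right hW.2, mlieBracket_neg_left hZ.2, neg_neg] at h
  simp only [IsType10, bracket, ← h]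
  abel

lemma cDiffAt_bracket [CompleteSpace E] {Z W : Π x : M, CTan E x} {U : Set M} (hU : IsOpen U)
    (hZ : SmoothOn Z U) (hW : SmoothOn W U) {x : M} (hx : x ∈ U) : CDiffAt (bracket Z W) x := by
  have key {X Y : Π x : M, RTan E x}
      (hX : ContMDiffOn 𝓘(ℝ, E) 𝓘(ℝ, E).tangent ∞
        (fun x => (⟨x, X x⟩ : TangentBundle 𝓘(ℝ, E) M)) U)
      (hY : ContMDiffOn 𝓘(ℝ, E) 𝓘(ℝ, E).tangent ∞
        (fun x => (⟨x, Y x⟩ : TangentBundle 𝓘(ℝ, E) M)) U) :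
      RDiffAt (VectorField.mlieBracket 𝓘(ℝ, E) X Y) x := by
    have hX' := (hX.contMDiffAt (hU.mem_nhds hx)).of_le (m := ((2 : ℕ∞) : ℕ∞ω))
      (by exact_mod_cast le_top)
    have hY' := (hY.contMDiffAt (hU.mem_nhds hx)).of_le (m := ((2 : ℕ∞) : ℕ∞ω))
      (by exact_mod_cast le_top)
    exact (hX'.mlieBracket_vectorField (m := 1) (n := 2) hY'
      (by rw [minSmoothness_of_isRCLikeNormedField]; norm_num)).mdifferentiableAt (by simp)
  exact ⟨mdifferentiableAt_sub_section (E := (RTan E : M → Type _)) (key hZ.1 hW.1) (key hZ.2 hW.2),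
    mdifferentiableAt_add_section (E := (RTan E : M → Type _)) (key hZ.1 hW.2) (key hZ.2 hW.1)⟩

lemma smoothOn_frame {g : Metric E M} {e : Fin n → Π x : M, CTan E x} {U : Set M}
    (he : IsUnitaryFrameOn g e U) (A : Fin n ⊕ Fin n) : SmoothOn (frame e A) U := by
  rcases A with i | j
  · exact he.smooth i
  · refine ⟨(he.smooth j).1, ?_⟩
    exact ContMDiffOn.neg_section (V := (RTan E : M → Type _)) (he.smooth j).2

lemma cTorsion_apply [FiniteDimensional ℂ E] (D : Connection E M) {Z W : Π x : M, CTan E x} {x : M}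
    (hZ : CDiffAt Z x) (hW : CDiffAt W x) :
    cTorsion D (Z x) (W x) = covD D Z W x - covD D W Z x - bracket Z W x := by
  simp only [cTorsion, covD, bracket, D.torsion_apply hZ.1 hW.1, D.torsion_apply hZ.2 hW.2,
    D.torsion_apply hZ.1 hW.2, D.torsion_apply hZ.2 hW.1]
  ext
  · simp only [Prod.fst_sub]; abel
  · simp only [Prod.snd_sub]; abel

end coefficients

section symmetries

variable [IsManifold 𝓘(ℂ, E) ω M] {n : ℕ} {g : Metric E M} {e : Fin n → Π x : M, CTan E x}
  {U : Set M} {x : M} {D : Connection E M}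

lemma IsUnitaryFrameOn.eventually_type10 (hU : IsOpen U) (he : IsUnitaryFrameOn g e U)
    (hx : x ∈ U) (i : Fin n) : ∀ᶠ y in nhds x, IsType10 (frame e (Sum.inl i) y) := by
  filter_upwards [hU.mem_nhds hx] with y hy using he.type10 i y hy

/-- `D g = 0` in terms of connection coefficients. -/
lemma connCoeff_skew (hg : IsHermitianMetric g) (hU : IsOpen U) (he : IsUnitaryFrameOn g e U)
    (hx : x ∈ U) (hD : IsMetricConnection g D) (A B C : Fin n ⊕ Fin n) :
    connCoeff g D e A C B x = -connCoeff g D e A B C x := by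
  have h := hD.dirDeriv_cInner g (frame e A) (he.cDiffAt_frame hU hx B)
    (he.cDiffAt_frame hU hx C)
  rw [dirDeriv_congr (f' := fun _ => if B = C.swap then 1 else 0), dirDeriv_const,
    cInner_comm g (frame e B x)] at h
  · simp only [connCoeff]
    linear_combination -h
  · filter_upwards [hU.mem_nhds hx] with y hy using he.cInner_frame hg hy B C

lemma connCoeff_swap (hU : IsOpen U) (he : IsUnitaryFrameOn g e U)
    (hx : x ∈ U) (A B C : Fin n ⊕ Fin n) :
    connCoeff g D e A.swap B.swap C.swap x = (starRingEnd ℂ) (connCoeff g D e A B C x) := by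
  rw [connCoeff, ← conjField_frame, ← conjField_frame, ← conj_frame,
    covD_conjField D _ (he.cDiffAt_frame hU hx B), cInner_conj, connCoeff]

/-- `D J = 0` in terms of connection coefficients. -/
lemma connCoeff_inl_inl (hg : IsHermitianMetric g) (hU : IsOpen U) (he : IsUnitaryFrameOn g e U)
    (hx : x ∈ U) (hD : PreservesJ D) (A : Fin n ⊕ Fin n) (k l : Fin n) :
    connCoeff g D e A (Sum.inl k) (Sum.inl l) x = 0 :=
  cInner_type10 hg (isType10_covD hD _ (he.cDiffAt_frame hU hx _) (he.eventually_type10 hU hx k))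
    (he.type10 l x hx)

lemma connCoeff_inr_inr (hg : IsHermitianMetric g) (hU : IsOpen U) (he : IsUnitaryFrameOn g e U)
    (hx : x ∈ U) (hD : PreservesJ D) (A : Fin n ⊕ Fin n) (k l : Fin n) :
    connCoeff g D e A (Sum.inr k) (Sum.inr l) x = 0 := by
  have h := connCoeff_swap (D := D) hU he hx A.swap (Sum.inl k) (Sum.inl l)
  rwa [connCoeff_inl_inl hg hU he hx hD, map_zero, Sum.swap_swap] at h

variable [FiniteDimensional ℂ E]

lemma torsCoeff_eq (hU : IsOpen U) (he : IsUnitaryFrameOn g e U) (hx : x ∈ U)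
    (A B C : Fin n ⊕ Fin n) :
    torsCoeff g D e A B C x
      = connCoeff g D e A B C x - connCoeff g D e B A C x - brCoeff g e A B C x := by
  rw [torsCoeff, cTorsion_apply D (he.cDiffAt_frame hU hx A) (he.cDiffAt_frame hU hx B),
    cInner_sub_left, cInner_sub_left]
  rfl

lemma cTorsion_antisymm (z w : CTan E x) : cTorsion D w z = -cTorsion D z w := by
  have h (u v : RTan E x) := D.torsion_antisymm u v
  simp only [cTorsion, h w.1, h w.2]
  ext
  · simp only [Prod.fst_neg]; abel
  · simp only [Prod.snd_neg]; abel

lemma torsCoeff_antisymm (A B C : Fin n ⊕ Fin n) :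
    torsCoeff g D e B A C x = -torsCoeff g D e A B C x := by
  rw [torsCoeff, torsCoeff, cTorsion_antisymm, cInner_neg_left]

lemma torsCoeff_swap (A B C : Fin n ⊕ Fin n) :
    torsCoeff g D e A.swap B.swap C.swap x = (starRingEnd ℂ) (torsCoeff g D e A B C x) := by
  rw [torsCoeff, torsCoeff, ← cInner_conj, ← conj_frame, ← conj_frame, ← conj_frame]
  congr 1
  simp only [cTorsion, conj]
  ext
  · simp
  · simp; abel

/-- The torsion of a connection with `D J = 0` maps pairs of `(1,0)` vectors to `(1,0)` vectors,
because `J` is integrable. -/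
lemma torsCoeff_inl_inl_inl (hg : IsHermitianMetric g) (hU : IsOpen U)
    (he : IsUnitaryFrameOn g e U) (hx : x ∈ U) (hD : PreservesJ D) (i k l : Fin n) :
    torsCoeff g D e (Sum.inl i) (Sum.inl k) (Sum.inl l) x = 0 := by
  have h : brCoeff g e (Sum.inl i) (Sum.inl k) (Sum.inl l) x = 0 :=
    cInner_type10 hg (isType10_bracket (he.cDiffAt_frame hU hx _) (he.cDiffAt_frame hU hx _)
      (he.eventually_type10 hU hx i) (he.eventually_type10 hU hx k)) (he.type10 l x hx)
  rw [torsCoeff_eq hU he hx, connCoeff_inl_inl hg hU he hx hD, connCoeff_inl_inl hg hU he hx hD, h]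
  ring

lemma torsCoeff_inl_inr (hD : IsChern g D) (he : IsUnitaryFrameOn g e U) (hx : x ∈ U)
    (i j : Fin n) (C : Fin n ⊕ Fin n) : torsCoeff g D e (Sum.inl i) (Sum.inr j) C x = 0 := by
  have h : cTorsion D (frame e (Sum.inl i) x) (frame e (Sum.inr j) x) = 0 :=
    hD.torsion_11 x _ _ (he.type10 i x hx) (he.type10 j x hx)
  rw [torsCoeff, h]
  apply Complex.ext <;> simp [cInner]

lemma torsCoeff_inr_inl (hD : IsChern g D) (he : IsUnitaryFrameOn g e U) (hx : x ∈ U)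
    (i j : Fin n) (C : Fin n ⊕ Fin n) : torsCoeff g D e (Sum.inr j) (Sum.inl i) C x = 0 := by
  rw [torsCoeff_antisymm, torsCoeff_inl_inr hD he hx, neg_zero]

/-- Total skew-symmetry of the torsion of the Bismut connection. -/
lemma IsBismut.torsCoeff_skew (hD : IsBismut g D) (A B C : Fin n ⊕ Fin n) :
    torsCoeff g D e A C B x = -torsCoeff g D e A B C x := by
  apply Complex.ext <;>
  simp only [torsCoeff, cInner, cTorsion, map_add, map_sub, add_apply, sub_apply,
    Complex.neg_re, Complex.neg_im, hD.torsion_skew x _ (frame e C x).1,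
    hD.torsion_skew x _ (frame e C x).2] <;> ring

/-! ### The Levi-Civita, Bismut and canonical connections in terms of the Chern connection -/

/-- The Koszul formula in a frame with constant inner products. -/
lemma IsLeviCivita.two_mul_connCoeff (hg : IsHermitianMetric g) (hU : IsOpen U)
    (he : IsUnitaryFrameOn g e U) (hx : x ∈ U) (hD : IsLeviCivita g D) (A B C : Fin n ⊕ Fin n) :
    2 * connCoeff g D e A B C x
      = brCoeff g e A B C x - brCoeff g e B C A x + brCoeff g e C A B x := by
  have h (A B C : Fin n ⊕ Fin n) := torsCoeff_eq (D := D) hU he hx A B C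
  have h0 (A B C : Fin n ⊕ Fin n) : torsCoeff g D e A B C x = 0 := by
    simp only [torsCoeff, cTorsion, hD.torsion_free]
    apply Complex.ext <;> simp [cInner]
  simp only [h0] at h
  linear_combination h B C A - h A B C - h C A B
    + connCoeff_skew hg hU he hx hD.metric A B C
    + connCoeff_skew hg hU he hx hD.metric B C A
    - connCoeff_skew hg hU he hx hD.metric C A B

/-- The difference of the Levi-Civita connection and a metric connection `D'` in terms of the
torsion of `D'`. -/
lemma IsLeviCivita.connCoeff_eq (hg : IsHermitianMetric g) (hU : IsOpen U)
    (he : IsUnitaryFrameOn g e U) (hx : x ∈ U) (hD : IsLeviCivita g D) {D' : Connection E M}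
    (hD' : IsMetricConnection g D') (A B C : Fin n ⊕ Fin n) :
    connCoeff g D e A B C x = connCoeff g D' e A B C x
      - (torsCoeff g D' e A B C x - torsCoeff g D' e B C A x + torsCoeff g D' e C A B x) / 2 := by
  have h (A B C : Fin n ⊕ Fin n) := torsCoeff_eq (D := D') hU he hx A B C
  linear_combination (hD.two_mul_connCoeff hg hU he hx A B C) / 2
    + (h A B C - h B C A + h C A B) / 2
    + (-connCoeff_skew hg hU he hx hD' A B C
    + connCoeff_skew hg hU he hx hD' C A B
    - connCoeff_skew hg hU he hx hD' B C A) / 2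

variable {levi chern bismut : Connection E M}

/-- `⟨∇^b_{e_i} e_k, ē_l⟩ = ⟨∇^c_{e_i} e_k, ē_l⟩ - T^l_{ik}`. -/
lemma IsBismut.connCoeff_inl (hg : IsHermitianMetric g) (hU : IsOpen U)
    (he : IsUnitaryFrameOn g e U) (hx : x ∈ U) (hb : IsBismut g bismut) (hc : IsChern g chern)
    (i k l : Fin n) :
    connCoeff g bismut e (Sum.inl i) (Sum.inl k) (Sum.inr l) x
      = connCoeff g chern e (Sum.inl i) (Sum.inl k) (Sum.inr l) x
        - torsCoeff g chern e (Sum.inl i) (Sum.inl k) (Sum.inr l) x := by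
  rw [torsCoeff_antisymm (Sum.inl k) (Sum.inl i), sub_neg_eq_add]
  -- compare `⟨T^b(e_k, ē_l), e_i⟩` with `⟨T^b(e_i, e_k), ē_l⟩`
  have h1 := torsCoeff_eq (D := bismut) hU he hx (Sum.inl k) (Sum.inr l) (Sum.inl i)
  have h2 := torsCoeff_eq (D := chern) hU he hx (Sum.inl k) (Sum.inr l) (Sum.inl i)
  have h3 := torsCoeff_eq (D := bismut) hU he hx (Sum.inl k) (Sum.inl i) (Sum.inr l)
  have h4 := torsCoeff_eq (D := chern) hU he hx (Sum.inl k) (Sum.inl i) (Sum.inr l)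
  rw [torsCoeff_inl_inr hc he hx, connCoeff_inl_inl hg hU he hx hc.preservesJ] at h2
  rw [connCoeff_inl_inl hg hU he hx hb.preservesJ] at h1
  have h5 := hb.torsCoeff_skew (e := e) (x := x) (Sum.inl k) (Sum.inl i) (Sum.inr l)
  have h6 := connCoeff_skew hg hU he hx hb.metric (Sum.inl k) (Sum.inl i) (Sum.inr l)
  have h7 := connCoeff_skew hg hU he hx hc.metric (Sum.inl k) (Sum.inl i) (Sum.inr l)
  linear_combination h1 - h2 + h3 - h4 - h5 + h6 - h7

lemma IsBismut.connCoeff_inr (hg : IsHermitianMetric g) (hU : IsOpen U)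
    (he : IsUnitaryFrameOn g e U) (hx : x ∈ U) (hb : IsBismut g bismut) (hc : IsChern g chern)
    (j k l : Fin n) :
    connCoeff g bismut e (Sum.inr j) (Sum.inl k) (Sum.inr l) x
      = connCoeff g chern e (Sum.inr j) (Sum.inl k) (Sum.inr l) x
        + (starRingEnd ℂ) (torsCoeff g chern e (Sum.inl j) (Sum.inl l) (Sum.inr k) x) := by
  have h := hb.connCoeff_inl hg hU he hx hc j l k
  have h1 := connCoeff_swap (D := bismut) hU he hx (Sum.inl j) (Sum.inl l) (Sum.inr k)
  have h2 := connCoeff_swap (D := chern) hU he hx (Sum.inl j) (Sum.inl l) (Sum.inr k)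
  simp only [Sum.swap_inl, Sum.swap_inr] at h1 h2
  rw [connCoeff_skew hg hU he hx hb.metric, connCoeff_skew hg hU he hx hc.metric _ (Sum.inr l),
    h1, h2, h, map_sub]
  ring

end symmetries

section canonical

variable [IsManifold 𝓘(ℂ, E) ω M] {n : ℕ} {g : Metric E M} {e : Fin n → Π x : M, CTan E x}
  {U : Set M} {x : M} {D D' levi chern bismut : Connection E M}

lemma connCoeff_affineCombination (a : ℝ) (A B C : Fin n ⊕ Fin n) :
    connCoeff g (D.affineCombination D' (fun _ => a)) e A B C x
      = a * connCoeff g D e A B C x + (1 - a) * connCoeff g D' e A B C x := by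
  apply Complex.ext <;> simp [connCoeff, covD, cInner] <;> ring

lemma IsMetricConnection.affineCombination (hD : IsMetricConnection g D)
    (hD' : IsMetricConnection g D') (a : ℝ) :
    IsMetricConnection g (D.affineCombination D' (fun _ => a)) := by
  intro Y Z x hY hZ v
  have h := hD Y Z x hY hZ v
  have h' := hD' Y Z x hY hZ v
  simp only [CovariantDerivative.affineCombination_toFun, Pi.add_apply, Pi.smul_apply',
    Pi.sub_apply, Pi.one_apply, add_apply, smul_apply, map_add, map_smul, smul_eq_mul]
  linear_combination a * h + (1 - a) * h'

lemma connCoeff_canonical (r s : ℝ) (A B C : Fin n ⊕ Fin n) :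
    connCoeff g (canonical levi chern bismut r s) e A B C x
      = s * connCoeff g levi e A B C x + (1 - s) * ((1 + r) / 2 * connCoeff g chern e A B C x
        + (1 - r) / 2 * connCoeff g bismut e A B C x) := by
  rw [canonical, gauduchon, connCoeff_affineCombination, connCoeff_affineCombination]
  push_cast
  ring

/-- The Bismut connection is `D^{-1}_0`. -/
lemma canonical_neg_one_zero : canonical levi chern bismut (-1) 0 = bismut := by
  ext Y x v
  simp [canonical, gauduchon]

variable [FiniteDimensional ℂ E]

lemma isMetricConnection_canonical (hl : IsLeviCivita g levi) (hc : IsChern g chern)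
    (hb : IsBismut g bismut) (r s : ℝ) :
    IsMetricConnection g (canonical levi chern bismut r s) :=
  hl.metric.affineCombination (hc.metric.affineCombination hb.metric _) s

/-- `⟨D_{e_i} e_k, ē_l⟩ = ⟨∇^c_{e_i} e_k, ē_l⟩ - t T^l_{ik}`. -/
lemma connCoeff_canonical_inl (hg : IsHermitianMetric g) (hU : IsOpen U)
    (he : IsUnitaryFrameOn g e U) (hx : x ∈ U) (hl : IsLeviCivita g levi) (hc : IsChern g chern)
    (hb : IsBismut g bismut) {r s t : ℝ}
    (ht : t = (1 - r + r * s) / 2) (i k l : Fin n) :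
    connCoeff g (canonical levi chern bismut r s) e (Sum.inl i) (Sum.inl k) (Sum.inr l) x
      = connCoeff g chern e (Sum.inl i) (Sum.inl k) (Sum.inr l) x
        - t * torsCoeff g chern e (Sum.inl i) (Sum.inl k) (Sum.inr l) x := by
  rw [connCoeff_canonical, hb.connCoeff_inl hg hU he hx hc, hl.connCoeff_eq hg hU he hx hc.metric,
    torsCoeff_inl_inr hc he hx, torsCoeff_inr_inl hc he hx, ht]
  push_cast
  ring

/-- `⟨D_{ē_j} e_k, ē_l⟩ = ⟨∇^c_{ē_j} e_k, ē_l⟩ + t conj(T^k_{jl})`. -/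
lemma connCoeff_canonical_inr (hg : IsHermitianMetric g) (hU : IsOpen U)
    (he : IsUnitaryFrameOn g e U) (hx : x ∈ U) (hl : IsLeviCivita g levi) (hc : IsChern g chern)
    (hb : IsBismut g bismut) {r s t : ℝ}
    (ht : t = (1 - r + r * s) / 2) (j k l : Fin n) :
    connCoeff g (canonical levi chern bismut r s) e (Sum.inr j) (Sum.inl k) (Sum.inr l) x
      = connCoeff g chern e (Sum.inr j) (Sum.inl k) (Sum.inr l) x
        + t * (starRingEnd ℂ) (torsCoeff g chern e (Sum.inl j) (Sum.inl l) (Sum.inr k) x) := by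
  have h := torsCoeff_swap (g := g) (D := chern) (e := e) (x := x) (Sum.inl j) (Sum.inl l)
    (Sum.inr k)
  simp only [Sum.swap_inl, Sum.swap_inr] at h
  rw [connCoeff_canonical, hb.connCoeff_inr hg hU he hx hc, hl.connCoeff_eq hg hU he hx hc.metric,
    torsCoeff_inl_inr hc he hx, torsCoeff_inr_inl hc he hx,
    torsCoeff_antisymm (Sum.inr j) (Sum.inr l), ← h, ht]
  push_cast
  ring

lemma connCoeff_canonical_inl_inl_inl (hg : IsHermitianMetric g) (hU : IsOpen U)
    (he : IsUnitaryFrameOn g e U) (hx : x ∈ U) (hl : IsLeviCivita g levi) (hc : IsChern g chern)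
    (hb : IsBismut g bismut) (r s : ℝ)
    (i k l : Fin n) :
    connCoeff g (canonical levi chern bismut r s) e (Sum.inl i) (Sum.inl k) (Sum.inl l) x = 0 := by
  simp only [connCoeff_canonical, connCoeff_inl_inl hg hU he hx hb.preservesJ,
    hl.connCoeff_eq hg hU he hx hc.metric, connCoeff_inl_inl hg hU he hx hc.preservesJ,
    torsCoeff_inl_inl_inl hg hU he hx hc.preservesJ]
  ring

/-- `⟨D_{ē_j} e_k, e_l⟩ = (s/2) T^j_{kl}`: the only part of `D` that does not commute with `J`. -/
lemma connCoeff_canonical_inr_inl_inl (hg : IsHermitianMetric g) (hU : IsOpen U)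
    (he : IsUnitaryFrameOn g e U) (hx : x ∈ U) (hl : IsLeviCivita g levi) (hc : IsChern g chern)
    (hb : IsBismut g bismut) (r s : ℝ)
    (j k l : Fin n) :
    connCoeff g (canonical levi chern bismut r s) e (Sum.inr j) (Sum.inl k) (Sum.inl l) x
      = s / 2 * torsCoeff g chern e (Sum.inl k) (Sum.inl l) (Sum.inr j) x := by
  simp only [connCoeff_canonical, connCoeff_inl_inl hg hU he hx hb.preservesJ,
    hl.connCoeff_eq hg hU he hx hc.metric, connCoeff_inl_inl hg hU he hx hc.preservesJ,
    torsCoeff_inl_inr hc he hx, torsCoeff_inr_inl hc he hx]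
  ring

end canonical

/-! ### Differentiability of the coefficients -/

section differentiability

variable [IsManifold 𝓘(ℂ, E) ω M] {n : ℕ} {g : Metric E M} {e : Fin n → Π x : M, CTan E x}
  {U : Set M} {x : M} {D levi chern bismut : Connection E M}

/-- For a metric connection with `D J = 0`, all coefficients are determined by
`⟨D_{ē_j} e_k, ē_l⟩`. -/
lemma mdifferentiableAt_connCoeff_of_inr (hg : IsHermitianMetric g) (hU : IsOpen U)
    (he : IsUnitaryFrameOn g e U) (hx : x ∈ U) (hD : IsMetricConnection g D) (hJ : PreservesJ D)
    (h : ∀ j k l, MDifferentiableAt 𝓘(ℝ, E) 𝓘(ℝ, ℂ)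
      (connCoeff g D e (Sum.inr j) (Sum.inl k) (Sum.inr l)) x)
    (A B C : Fin n ⊕ Fin n) :
    MDifferentiableAt 𝓘(ℝ, E) 𝓘(ℝ, ℂ) (connCoeff g D e A B C) x := by
  have h0 : MDifferentiableAt 𝓘(ℝ, E) 𝓘(ℝ, ℂ) (fun _ : M => (0 : ℂ)) x := mdifferentiableAt_const
  have hskew {A B C : Fin n ⊕ Fin n}
      (h : MDifferentiableAt 𝓘(ℝ, E) 𝓘(ℝ, ℂ) (connCoeff g D e A B C) x) :
      MDifferentiableAt 𝓘(ℝ, E) 𝓘(ℝ, ℂ) (connCoeff g D e A C B) x := by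
    refine (mdifferentiableAt_const_mul (-1) h).congr_of_eventuallyEq ?_
    filter_upwards [hU.mem_nhds hx] with y hy
    rw [connCoeff_skew hg hU he hy hD, neg_one_mul]
  have hinl (i k l : Fin n) : MDifferentiableAt 𝓘(ℝ, E) 𝓘(ℝ, ℂ)
      (connCoeff g D e (Sum.inl i) (Sum.inr k) (Sum.inl l)) x := by
    refine (mdifferentiableAt_star (h i k l)).congr_of_eventuallyEq ?_
    filter_upwards [hU.mem_nhds hx] with y hy
    rw [← connCoeff_swap hU he hy]
    rfl
  rcases B with k | k <;> rcases C with l | l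
  · refine h0.congr_of_eventuallyEq ?_
    filter_upwards [hU.mem_nhds hx] with y hy
    exact connCoeff_inl_inl hg hU he hy hJ A k l
  · rcases A with i | j
    · exact hskew (hinl i l k)
    · exact h j k l
  · rcases A with i | j
    · exact hinl i k l
    · exact hskew (h j l k)
  · refine h0.congr_of_eventuallyEq ?_
    filter_upwards [hU.mem_nhds hx] with y hy
    exact connCoeff_inr_inr hg hU he hy hJ A k l

variable [FiniteDimensional ℂ E]

lemma mdifferentiableAt_brCoeff (hU : IsOpen U) (he : IsUnitaryFrameOn g e U) (hx : x ∈ U)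
    (A B C : Fin n ⊕ Fin n) :
    MDifferentiableAt 𝓘(ℝ, E) 𝓘(ℝ, ℂ) (brCoeff g e A B C) x :=
  mdifferentiableAt_cInner g (cDiffAt_bracket hU (smoothOn_frame he A) (smoothOn_frame he B) hx)
    (he.cDiffAt_frame hU hx C)

/-- Connections are not assumed to be smooth: for the Levi-Civita connection, the coefficients are
differentiable by the Koszul formula. -/
lemma IsLeviCivita.mdifferentiableAt_connCoeff (hg : IsHermitianMetric g) (hU : IsOpen U)
    (he : IsUnitaryFrameOn g e U) (hx : x ∈ U) (hD : IsLeviCivita g D) (A B C : Fin n ⊕ Fin n) :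
    MDifferentiableAt 𝓘(ℝ, E) 𝓘(ℝ, ℂ) (connCoeff g D e A B C) x := by
  have h (A B C : Fin n ⊕ Fin n) := mdifferentiableAt_brCoeff hU he hx A B C
  refine (mdifferentiableAt_const_mul (1 / 2)
    (((h A B C).sub (h B C A)).add (h C A B))).congr_of_eventuallyEq ?_
  filter_upwards [hU.mem_nhds hx] with y hy
  have h2 := hD.two_mul_connCoeff hg hU he hy A B C
  simp only [Pi.add_apply, Pi.sub_apply]
  linear_combination h2 / 2

lemma IsChern.mdifferentiableAt_connCoeff (hg : IsHermitianMetric g) (hU : IsOpen U)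
    (he : IsUnitaryFrameOn g e U) (hx : x ∈ U) (hD : IsChern g D) (A B C : Fin n ⊕ Fin n) :
    MDifferentiableAt 𝓘(ℝ, E) 𝓘(ℝ, ℂ) (connCoeff g D e A B C) x := by
  refine mdifferentiableAt_connCoeff_of_inr hg hU he hx hD.metric hD.preservesJ
    (fun j k l => ?_) A B C
  refine (mdifferentiableAt_brCoeff hU he hx (Sum.inr j) (Sum.inl k)
    (Sum.inr l)).congr_of_eventuallyEq ?_
  filter_upwards [hU.mem_nhds hx] with y hy
  have h := torsCoeff_eq (D := D) hU he hy (Sum.inr j) (Sum.inl k) (Sum.inr l)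
  rw [torsCoeff_inr_inl hD he hy, connCoeff_inr_inr hg hU he hy hD.preservesJ] at h
  linear_combination -h

lemma IsChern.mdifferentiableAt_torsCoeff (hg : IsHermitianMetric g) (hU : IsOpen U)
    (he : IsUnitaryFrameOn g e U) (hx : x ∈ U) (hD : IsChern g D) (A B C : Fin n ⊕ Fin n) :
    MDifferentiableAt 𝓘(ℝ, E) 𝓘(ℝ, ℂ) (torsCoeff g D e A B C) x := by
  refine (((hD.mdifferentiableAt_connCoeff hg hU he hx A B C).sub
    (hD.mdifferentiableAt_connCoeff hg hU he hx B A C)).sub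
    (mdifferentiableAt_brCoeff hU he hx A B C)).congr_of_eventuallyEq ?_
  filter_upwards [hU.mem_nhds hx] with y hy using torsCoeff_eq hU he hy A B C

lemma IsBismut.mdifferentiableAt_connCoeff (hg : IsHermitianMetric g) (hU : IsOpen U)
    (he : IsUnitaryFrameOn g e U) (hx : x ∈ U) (hb : IsBismut g bismut) (hc : IsChern g chern)
    (A B C : Fin n ⊕ Fin n) :
    MDifferentiableAt 𝓘(ℝ, E) 𝓘(ℝ, ℂ) (connCoeff g bismut e A B C) x := by
  refine mdifferentiableAt_connCoeff_of_inr hg hU he hx hb.metric hb.preservesJ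
    (fun j k l => ?_) A B C
  refine ((hc.mdifferentiableAt_connCoeff hg hU he hx (Sum.inr j) (Sum.inl k) (Sum.inr l)).add
    (mdifferentiableAt_star (hc.mdifferentiableAt_torsCoeff hg hU he hx (Sum.inl j) (Sum.inl l)
      (Sum.inr k)))).congr_of_eventuallyEq ?_
  filter_upwards [hU.mem_nhds hx] with y hy using hb.connCoeff_inr hg hU he hy hc j k l

lemma mdifferentiableAt_connCoeff_canonical (hg : IsHermitianMetric g) (hU : IsOpen U)
    (he : IsUnitaryFrameOn g e U) (hx : x ∈ U) (hl : IsLeviCivita g levi) (hc : IsChern g chern)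
    (hb : IsBismut g bismut) (r s : ℝ) (A B C : Fin n ⊕ Fin n) :
    MDifferentiableAt 𝓘(ℝ, E) 𝓘(ℝ, ℂ)
      (connCoeff g (canonical levi chern bismut r s) e A B C) x := by
  refine ((mdifferentiableAt_const_mul (s : ℂ)
    (hl.mdifferentiableAt_connCoeff hg hU he hx A B C)).add
    (mdifferentiableAt_const_mul (1 - s : ℂ) ((mdifferentiableAt_const_mul ((1 + r) / 2 : ℂ)
    (hc.mdifferentiableAt_connCoeff hg hU he hx A B C)).add
    (mdifferentiableAt_const_mul ((1 - r) / 2 : ℂ)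
    (hb.mdifferentiableAt_connCoeff hg hU he hx hc A B C))))).congr_of_eventuallyEq ?_
  exact Filter.Eventually.of_forall fun y => connCoeff_canonical r s A B C

end differentiability

/-! ### Curvature and derivative of the torsion in a unitary frame -/

section curvature

variable [IsManifold 𝓘(ℂ, E) ω M] [FiniteDimensional ℂ E] {n : ℕ} {g : Metric E M}
  {e : Fin n → Π x : M, CTan E x}
  {U : Set M} {x : M} {D D' : Connection E M}

/-- `⟨D_{E_A} Z, E_B⟩` by the product rule for the metric. -/
lemma IsMetricConnection.cInner_covD (hg : IsHermitianMetric g) (hU : IsOpen U)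
    (he : IsUnitaryFrameOn g e U) (hx : x ∈ U) (hD : IsMetricConnection g D)
    {Z : Π x : M, CTan E x} (hZ : CDiffAt Z x) (A B : Fin n ⊕ Fin n) :
    cInner g (covD D (frame e A) Z x) (frame e B x)
      = dirDeriv (frame e A) (fun y => cInner g (Z y) (frame e B y)) x
        - ∑ Q, cInner g (Z x) (frame e Q.swap x) * connCoeff g D e A B Q x := by
  have h1 := hD.dirDeriv_cInner g (frame e A) hZ (he.cDiffAt_frame hU hx B)
  have h2 := he.cInner_expansion hg hx (Z x) (covD D (frame e A) (frame e B) x)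
  simp only [cInner_comm g (frame e _ x) (covD D (frame e A) (frame e B) x)] at h2
  simp only [connCoeff]
  linear_combination -h1 - h2

/-- `D_Z E_B` is `ℂ`-linear in the value of `Z` at the point, so it expands along the frame. -/
lemma cInner_covD_expansion (hg : IsHermitianMetric g)
    (he : IsUnitaryFrameOn g e U) (hx : x ∈ U) (Z : Π x : M, CTan E x) (B C : Fin n ⊕ Fin n) :
    cInner g (covD D Z (frame e B) x) (frame e C x)
      = ∑ Q, cInner g (Z x) (frame e Q.swap x) * connCoeff g D e Q B C x := by
  let φ : RTan E x →ₗ[ℝ] ℂ :=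
    { toFun := fun u => cInner g (x := x) (D (fun y => (frame e B y).1) x u,
        D (fun y => (frame e B y).2) x u) (frame e C x)
      map_add' := fun u v => by apply Complex.ext <;> simp [cInner] <;> ring
      map_smul' := fun c u => by apply Complex.ext <;> simp [cInner] <;> ring }
  have h (Z : Π x : M, CTan E x) :
      complexify φ (Z x) = cInner g (covD D Z (frame e B) x) (frame e C x) := by
    apply Complex.ext <;> simp [complexify, φ, cInner, covD] <;> ring
  rw [← h, he.complexify_expansion hg hx φ]
  simp only [h]
  rfl

/-- `T(z, E_B)` is `ℂ`-linear in `z`, so it expands along the frame. -/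
lemma cInner_cTorsion_expansion (hg : IsHermitianMetric g)
    (he : IsUnitaryFrameOn g e U) (hx : x ∈ U) (z : CTan E x) (B C : Fin n ⊕ Fin n) :
    cInner g (cTorsion D z (frame e B x)) (frame e C x)
      = ∑ Q, cInner g z (frame e Q.swap x) * torsCoeff g D e Q B C x := by
  let φ : RTan E x →ₗ[ℝ] ℂ :=
    { toFun := fun u => cInner g (x := x) (D.torsion x u (frame e B x).1,
        D.torsion x u (frame e B x).2) (frame e C x)
      map_add' := fun u v => by apply Complex.ext <;> simp [cInner] <;> ring
      map_smul' := fun c u => by apply Complex.ext <;> simp [cInner] <;> ring }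
  have h (z : CTan E x) :
      complexify φ z = cInner g (cTorsion D z (frame e B x)) (frame e C x) := by
    apply Complex.ext <;> simp [complexify, φ, cInner, cTorsion] <;> ring
  rw [← h, he.complexify_expansion hg hx φ]
  simp only [h]
  rfl

/-- The curvature of a metric connection in terms of its coefficients. -/
lemma cInner_curvature (hg : IsHermitianMetric g) (hU : IsOpen U)
    (he : IsUnitaryFrameOn g e U) (hx : x ∈ U) (hD : IsMetricConnection g D)
    (hd : ∀ A B C, MDifferentiableAt 𝓘(ℝ, E) 𝓘(ℝ, ℂ) (connCoeff g D e A B C) x)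
    (A B C F : Fin n ⊕ Fin n) :
    cInner g (curvature D (frame e A) (frame e B) (frame e C) x) (frame e F x)
      = dirDeriv (frame e A) (connCoeff g D e B C F) x
        - ∑ Q, connCoeff g D e B C Q.swap x * connCoeff g D e A F Q x
        - (dirDeriv (frame e B) (connCoeff g D e A C F) x
          - ∑ Q, connCoeff g D e A C Q.swap x * connCoeff g D e B F Q x)
        - ∑ Q, brCoeff g e A B Q.swap x * connCoeff g D e Q C F x := by
  have hdiff (A B : Fin n ⊕ Fin n) : CDiffAt (covD D (frame e A) (frame e B)) x :=
    he.cDiffAt_of_cInner hg hU hx (hd A B)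
  simp only [curvature, Pi.sub_apply]
  rw [cInner_sub_left, cInner_sub_left, hD.cInner_covD hg hU he hx (hdiff B C),
    hD.cInner_covD hg hU he hx (hdiff A C), cInner_covD_expansion hg he hx]
  rfl

/-- The covariant derivative of the torsion of `D'` with respect to a metric connection `D` in
terms of coefficients. -/
lemma cInner_covDTorsion (hg : IsHermitianMetric g) (hU : IsOpen U)
    (he : IsUnitaryFrameOn g e U) (hx : x ∈ U) (hD : IsMetricConnection g D)
    (hd : ∀ A B C, MDifferentiableAt 𝓘(ℝ, E) 𝓘(ℝ, ℂ) (torsCoeff g D' e A B C) x)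
    (A B C F : Fin n ⊕ Fin n) :
    cInner g (covDTorsion D D' (frame e A) (frame e B) (frame e C) x) (frame e F x)
      = dirDeriv (frame e A) (torsCoeff g D' e B C F) x
        - ∑ Q, torsCoeff g D' e B C Q.swap x * connCoeff g D e A F Q x
        - ∑ Q, connCoeff g D e A B Q.swap x * torsCoeff g D' e Q C F x
        + ∑ Q, connCoeff g D e A C Q.swap x * torsCoeff g D' e Q B F x := by
  have hdiff : CDiffAt (torsionField D' (frame e B) (frame e C)) x :=
    he.cDiffAt_of_cInner hg hU hx (hd B C)
  simp only [covDTorsion, Pi.sub_apply]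
  rw [cInner_sub_left, cInner_sub_left, hD.cInner_covD hg hU he hx hdiff]
  simp only [torsionField]
  rw [cInner_cTorsion_expansion hg he hx, cTorsion_antisymm (covD D (frame e A) (frame e C) x),
    cInner_neg_left, cInner_cTorsion_expansion hg he hx, sub_neg_eq_add]
  rfl

end curvature

/-! ### The curvature formulas -/

/-- The terms of the curvature of `D` that contain no derivatives of coefficients, compared with
those of the Chern curvature and of the derivative of the torsion. Here `a i k l` and `b j k l`
stand for `⟨∇^c_{e_i} e_k, ē_l⟩` and `⟨∇^c_{ē_j} e_k, ē_l⟩`. -/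
lemma sum_quadratic_terms {n : ℕ} (a b T : Fin n → Fin n → Fin n → ℂ)
    (hT : ∀ l i k, T l k i = -T l i k) (s t : ℝ) (i j k l : Fin n) :
    ∑ q, ((b j k q + t * (starRingEnd ℂ) (T k j q)) * (a i q l - t * T l i q)
        - s / 2 * T j k q * (starRingEnd ℂ) (s / 2 * T i l q)
        - (a i k q - t * T q i k) * (b j q l + t * (starRingEnd ℂ) (T q j l))
        + b j i q * (a q k l - t * T l q k) + a i q j * (b q k l + t * (starRingEnd ℂ) (T k q l)))
      = ∑ q, (b j k q * a i q l - a i k q * b j q l + b j i q * a q k l + a i q j * b q k l)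
        + t * (∑ q, (T q i k * (b j q l + (starRingEnd ℂ) (T q j l))
            - (b j i q + (starRingEnd ℂ) (T i j q)) * T l q k
            + (b j k q + (starRingEnd ℂ) (T k j q)) * T l q i)
          + ∑ q, ((starRingEnd ℂ) (T q j l) * (-a i k q + T q i k)
            - (-a i q j + T j i q) * (starRingEnd ℂ) (T k q l)
            + (-a i q l + T l i q) * (starRingEnd ℂ) (T k q j)))
        + (t ^ 2 - 2 * t) * (wTerm T i j k l - vTerm T i l k j)
        - t * (vTerm T i j k l + vTerm T k l i j) - s ^ 2 / 4 * vTerm T k j i l := by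
  simp only [wTerm, vTerm, mul_add, mul_sub, Finset.mul_sum, ← Finset.sum_add_distrib,
    ← Finset.sum_sub_distrib]
  refine Finset.sum_congr rfl fun q _ => ?_
  rw [hT l k q, hT l i q, hT k l q, hT k j q]
  simp only [map_mul, map_neg, map_div₀, Complex.conj_ofReal, map_ofNat]
  ring

variable [FiniteDimensional ℂ E] [IsManifold 𝓘(ℂ, E) ω M] {n : ℕ} {g : Metric E M}
  {e : Fin n → Π x : M, CTan E x} {U : Set M} {p : M} {D levi chern bismut : Connection E M}

/-- The `(1,1)`-curvature of a metric connection `D` in terms of the coefficients of `D` and of the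
Chern connection, the latter accounting for the bracket
`[e_i, ē_j] = ∇^c_{e_i} ē_j - ∇^c_{ē_j} e_i`. -/
lemma curvComp_eq (hg : IsHermitianMetric g) (hU : IsOpen U) (he : IsUnitaryFrameOn g e U)
    (hp : p ∈ U) (hc : IsChern g chern) (hD : IsMetricConnection g D)
    (hd : ∀ A B C, MDifferentiableAt 𝓘(ℝ, E) 𝓘(ℝ, ℂ) (connCoeff g D e A B C) p)
    (h0 : ∀ i k l, connCoeff g D e (Sum.inl i) (Sum.inl k) (Sum.inl l) p = 0)
    (i j k l : Fin n) :
    curvComp g D e p i j k l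
      = dirDeriv (frame e (Sum.inl i)) (connCoeff g D e (Sum.inr j) (Sum.inl k) (Sum.inr l)) p
        - dirDeriv (frame e (Sum.inr j)) (connCoeff g D e (Sum.inl i) (Sum.inl k) (Sum.inr l)) p
        + ∑ q, (connCoeff g D e (Sum.inr j) (Sum.inl k) (Sum.inr q) p
              * connCoeff g D e (Sum.inl i) (Sum.inl q) (Sum.inr l) p
            - connCoeff g D e (Sum.inr j) (Sum.inl k) (Sum.inl q) p
              * (starRingEnd ℂ) (connCoeff g D e (Sum.inr i) (Sum.inl l) (Sum.inl q) p)
            - connCoeff g D e (Sum.inl i) (Sum.inl k) (Sum.inr q) p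
              * connCoeff g D e (Sum.inr j) (Sum.inl q) (Sum.inr l) p
            + connCoeff g chern e (Sum.inr j) (Sum.inl i) (Sum.inr q) p
              * connCoeff g D e (Sum.inl q) (Sum.inl k) (Sum.inr l) p
            + connCoeff g chern e (Sum.inl i) (Sum.inl q) (Sum.inr j) p
              * connCoeff g D e (Sum.inr q) (Sum.inl k) (Sum.inr l) p) := by
  have hbr (C : Fin n ⊕ Fin n) : brCoeff g e (Sum.inl i) (Sum.inr j) C p
      = connCoeff g chern e (Sum.inl i) (Sum.inr j) C p
        - connCoeff g chern e (Sum.inr j) (Sum.inl i) C p := by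
    have h := torsCoeff_eq (D := chern) hU he hp (Sum.inl i) (Sum.inr j) C
    rw [torsCoeff_inl_inr hc he hp] at h
    linear_combination h
  have hconj (q : Fin n) : connCoeff g D e (Sum.inl i) (Sum.inr l) (Sum.inr q) p
      = (starRingEnd ℂ) (connCoeff g D e (Sum.inr i) (Sum.inl l) (Sum.inl q) p) :=
    connCoeff_swap hU he hp (Sum.inr i) (Sum.inl l) (Sum.inl q)
  have h := cInner_curvature hg hU he hp hD hd (Sum.inl i) (Sum.inr j) (Sum.inl k) (Sum.inr l)
  refine h.trans ?_
  simp only [Fintype.sum_sum_type, Sum.swap_inl, Sum.swap_inr, hbr, hconj, h0,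
    connCoeff_inl_inl hg hU he hp hc.preservesJ, connCoeff_inr_inr hg hU he hp hc.preservesJ,
    connCoeff_skew hg hU he hp hc.metric _ (Sum.inl _) (Sum.inr _),
    fun A q => connCoeff_skew hg hU he hp hD A (Sum.inl q) (Sum.inr l),
    Finset.sum_add_distrib, Finset.sum_sub_distrib, zero_sub, sub_zero, mul_neg, neg_mul,
    zero_mul, Finset.sum_neg_distrib, Finset.sum_const_zero]
  ring

/-- The derivative of the Chern torsion with respect to the Bismut connection, in terms of Chern
coefficients. -/
lemma torsDerivComp_eq (hg : IsHermitianMetric g) (hU : IsOpen U) (he : IsUnitaryFrameOn g e U)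
    (hp : p ∈ U) (hc : IsChern g chern) (hb : IsBismut g bismut) (i j k l : Fin n) :
    torsDerivComp g bismut chern e p l i k j
      = dirDeriv (frame e (Sum.inr j)) (torsCoeff g chern e (Sum.inl i) (Sum.inl k) (Sum.inr l)) p
        + ∑ q, (torsComp g chern e p q i k
              * (connCoeff g chern e (Sum.inr j) (Sum.inl q) (Sum.inr l) p
                + (starRingEnd ℂ) (torsComp g chern e p q j l))
            - (connCoeff g chern e (Sum.inr j) (Sum.inl i) (Sum.inr q) p
                + (starRingEnd ℂ) (torsComp g chern e p i j q)) * torsComp g chern e p l q k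
            + (connCoeff g chern e (Sum.inr j) (Sum.inl k) (Sum.inr q) p
                + (starRingEnd ℂ) (torsComp g chern e p k j q)) * torsComp g chern e p l q i) := by
  have h := cInner_covDTorsion hg hU he hp hb.metric
    (hc.mdifferentiableAt_torsCoeff hg hU he hp) (Sum.inr j) (Sum.inl i) (Sum.inl k) (Sum.inr l)
  have hT (l i k : Fin n) : torsComp g chern e p l i k
      = torsCoeff g chern e (Sum.inl i) (Sum.inl k) (Sum.inr l) p := rfl
  refine h.trans ?_
  simp only [Fintype.sum_sum_type, Sum.swap_inl, Sum.swap_inr, hT,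
    torsCoeff_inl_inl_inl hg hU he hp hc.preservesJ,
    connCoeff_inl_inl hg hU he hp hb.preservesJ,
    fun q => connCoeff_skew hg hU he hp hb.metric (Sum.inr j) (Sum.inl q) (Sum.inr l),
    hb.connCoeff_inr hg hU he hp hc, Finset.sum_add_distrib, Finset.sum_sub_distrib,
    mul_neg, zero_mul, Finset.sum_neg_distrib, Finset.sum_const_zero]
  ring

lemma torsComp_antisymm (l i k : Fin n) :
    torsComp g D e p l k i = -torsComp g D e p l i k :=
  torsCoeff_antisymm (Sum.inl i) (Sum.inl k) (Sum.inr l)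

lemma torsDerivComp_antisymm (hg : IsHermitianMetric g) (hU : IsOpen U)
    (he : IsUnitaryFrameOn g e U) (hp : p ∈ U) (hc : IsChern g chern) (hb : IsBismut g bismut)
    (i j k l : Fin n) :
    torsDerivComp g bismut chern e p l k i j = -torsDerivComp g bismut chern e p l i k j := by
  have h : torsCoeff g chern e (Sum.inl k) (Sum.inl i) (Sum.inr l)
      = fun y => -1 * torsCoeff g chern e (Sum.inl i) (Sum.inl k) (Sum.inr l) y := by
    funext y
    rw [torsCoeff_antisymm, neg_one_mul]
  rw [torsDerivComp_eq hg hU he hp hc hb, torsDerivComp_eq hg hU he hp hc hb, h,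
    dirDeriv_const_mul _ (hc.mdifferentiableAt_torsCoeff hg hU he hp _ _ _), neg_add,
    ← Finset.sum_neg_distrib, neg_one_mul]
  congr 1
  refine Finset.sum_congr rfl fun q _ => ?_
  rw [torsComp_antisymm q i k]
  ring

/-- The curvature of the canonical metric connections. -/
lemma curvComp_canonical (hg : IsHermitianMetric g) (hU : IsOpen U) (he : IsUnitaryFrameOn g e U)
    (hp : p ∈ U) (hl : IsLeviCivita g levi) (hc : IsChern g chern) (hb : IsBismut g bismut)
    {r s t : ℝ} (ht : t = (1 - r + r * s) / 2) (i j k l : Fin n) :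
    curvComp g (canonical levi chern bismut r s) e p i j k l
      = curvComp g chern e p i j k l
        + t * (torsDerivComp g bismut chern e p l i k j
            + (starRingEnd ℂ) (torsDerivComp g bismut chern e p k j l i))
        + (t ^ 2 - 2 * t)
          * (wTerm (torsComp g chern e p) i j k l - vTerm (torsComp g chern e p) i l k j)
        - t * (vTerm (torsComp g chern e p) i j k l + vTerm (torsComp g chern e p) k l i j)
        - s ^ 2 / 4 * vTerm (torsComp g chern e p) k j i l := by
  have hT (l i k : Fin n) : torsCoeff g chern e (Sum.inl i) (Sum.inl k) (Sum.inr l) p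
      = torsComp g chern e p l i k := rfl
  have hTd (A B C : Fin n ⊕ Fin n) := hc.mdifferentiableAt_torsCoeff hg hU he hp A B C
  have hCd (A B C : Fin n ⊕ Fin n) := hc.mdifferentiableAt_connCoeff hg hU he hp A B C
  -- derivatives of the coefficients of `D`
  have hd1 : dirDeriv (frame e (Sum.inl i)) (connCoeff g (canonical levi chern bismut r s) e
        (Sum.inr j) (Sum.inl k) (Sum.inr l)) p
      = dirDeriv (frame e (Sum.inl i)) (connCoeff g chern e (Sum.inr j) (Sum.inl k) (Sum.inr l)) p
        + t * (starRingEnd ℂ) (dirDeriv (frame e (Sum.inr i))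
          (torsCoeff g chern e (Sum.inl j) (Sum.inl l) (Sum.inr k)) p) := by
    rw [← dirDeriv_conjField (hTd _ _ _), conjField_frame, Sum.swap_inr,
      ← dirDeriv_const_mul _ (mdifferentiableAt_star (hTd _ _ _)),
      ← dirDeriv_add (hCd _ _ _)
        (mdifferentiableAt_const_mul _ (mdifferentiableAt_star (hTd _ _ _)))]
    refine dirDeriv_congr ?_
    filter_upwards [hU.mem_nhds hp] with y hy
      using connCoeff_canonical_inr hg hU he hy hl hc hb ht j k l
  have hd2 : dirDeriv (frame e (Sum.inr j)) (connCoeff g (canonical levi chern bismut r s) e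
        (Sum.inl i) (Sum.inl k) (Sum.inr l)) p
      = dirDeriv (frame e (Sum.inr j)) (connCoeff g chern e (Sum.inl i) (Sum.inl k) (Sum.inr l)) p
        + -t * dirDeriv (frame e (Sum.inr j))
          (torsCoeff g chern e (Sum.inl i) (Sum.inl k) (Sum.inr l)) p := by
    rw [← dirDeriv_const_mul _ (hTd _ _ _),
      ← dirDeriv_add (hCd _ _ _) (mdifferentiableAt_const_mul _ (hTd _ _ _))]
    refine dirDeriv_congr ?_
    filter_upwards [hU.mem_nhds hp] with y hy
    rw [connCoeff_canonical_inl hg hU he hy hl hc hb ht i k l]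
    ring
  -- conjugates of Chern coefficients
  have hconj (i k l : Fin n) :
      (starRingEnd ℂ) (connCoeff g chern e (Sum.inr i) (Sum.inl l) (Sum.inr k) p)
        = -connCoeff g chern e (Sum.inl i) (Sum.inl k) (Sum.inr l) p := by
    rw [← connCoeff_swap hU he hp, ← connCoeff_skew hg hU he hp hc.metric]
    rfl
  have key := sum_quadratic_terms
    (fun i k l => connCoeff g chern e (Sum.inl i) (Sum.inl k) (Sum.inr l) p)
    (fun j k l => connCoeff g chern e (Sum.inr j) (Sum.inl k) (Sum.inr l) p)
    (torsComp g chern e p) torsComp_antisymm s t i j k l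
  rw [curvComp_eq hg hU he hp hc (isMetricConnection_canonical hl hc hb r s)
      (mdifferentiableAt_connCoeff_canonical hg hU he hp hl hc hb r s)
      (connCoeff_canonical_inl_inl_inl hg hU he hp hl hc hb r s),
    curvComp_eq hg hU he hp hc hc.metric hCd
      (fun i k l => connCoeff_inl_inl hg hU he hp hc.preservesJ _ k l),
    torsDerivComp_eq hg hU he hp hc hb, torsDerivComp_eq hg hU he hp hc hb, hd1, hd2]
  simp only [connCoeff_canonical_inl hg hU he hp hl hc hb ht,
    connCoeff_canonical_inr hg hU he hp hl hc hb ht,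
    connCoeff_canonical_inr_inl_inl hg hU he hp hl hc hb r s,
    connCoeff_inl_inl hg hU he hp hc.preservesJ, hT, map_add, map_sub, map_sum, map_mul, hconj,
    Complex.conj_conj, zero_mul, sub_zero] at key ⊢
  linear_combination key

/-- Symmetrization cancels `w` and the derivatives of the torsion, which are skew in `i`, `k` or in
`j`, `l`, and identifies the four `v`-terms. -/
lemma symmetrize_curvComp_canonical (hg : IsHermitianMetric g) (hU : IsOpen U)
    (he : IsUnitaryFrameOn g e U)
    (hp : p ∈ U) (hl : IsLeviCivita g levi) (hc : IsChern g chern) (hb : IsBismut g bismut)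
    {r s t : ℝ} (ht : t = (1 - r + r * s) / 2) (i j k l : Fin n) :
    symmetrize (curvComp g (canonical levi chern bismut r s) e p) i j k l
      = symmetrize (curvComp g chern e p) i j k l
        - (t ^ 2 + s ^ 2 / 4) * symmetrize (vTerm (torsComp g chern e p)) i j k l := by
  have hw (i j k l : Fin n) : wTerm (torsComp g chern e p) k j i l
      = -wTerm (torsComp g chern e p) i j k l := by
    simp only [wTerm, ← Finset.sum_neg_distrib, torsComp_antisymm _ i k, neg_mul]
  have hD (i j k l : Fin n) := torsDerivComp_antisymm hg hU he hp hc hb i j k l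
  simp only [symmetrize, curvComp_canonical hg hU he hp hl hc hb ht, hw i j k l, hw i l k j,
    hD i j k l, hD i l k j, hD j i l k, hD j k l i, map_neg]
  ring

end Hermitian

end

open Hermitian in
theorem lemma9 {E : Type*} [NormedAddCommGroup E] [NormedSpace ℂ E] [FiniteDimensional ℂ E]
    {M : Type*} [TopologicalSpace M] [ChartedSpace E M] [IsManifold 𝓘(ℂ, E) ω M]
    (g : Metric E M) (hg : IsHermitianMetric g)
    (levi chern bismut : Connection E M)
    (h_levi : IsLeviCivita g levi) (h_chern : IsChern g chern) (h_bismut : IsBismut g bismut)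
    {n : ℕ} (e : Fin n → Π x : M, CTan E x) (U : Set M) (hU : IsOpen U)
    (he : IsUnitaryFrameOn g e U) (r s t : ℝ) (ht : t = (1 - r + r * s) / 2)
    (p : M) (hp : p ∈ U) (i j k l : Fin n) :
    curvComp g (canonical levi chern bismut r s) e p i j k l
        = curvComp g chern e p i j k l
          + t * (torsDerivComp g bismut chern e p l i k j
              + (starRingEnd ℂ) (torsDerivComp g bismut chern e p k j l i))
          + (t ^ 2 - 2 * t)
            * (wTerm (torsComp g chern e p) i j k l - vTerm (torsComp g chern e p) i l k j)
          - t * (vTerm (torsComp g chern e p) i j k l + vTerm (torsComp g chern e p) k l i j)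
          - s ^ 2 / 4 * vTerm (torsComp g chern e p) k j i l ∧
      symmetrize (curvComp g (canonical levi chern bismut r s) e p) i j k l
        = symmetrize (curvComp g chern e p) i j k l
          - (t ^ 2 + s ^ 2 / 4) * symmetrize (vTerm (torsComp g chern e p)) i j k l ∧
      symmetrize (curvComp g (canonical levi chern bismut r s) e p) i j k l
        = symmetrize (curvComp g bismut e p) i j k l
          + (1 - t ^ 2 - s ^ 2 / 4) * symmetrize (vTerm (torsComp g chern e p)) i j k l := by
  have h2 := symmetrize_curvComp_canonical hg hU he hp h_levi h_chern h_bismut ht i j k l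
  -- the Bismut connection is the canonical connection with `(r, s) = (-1, 0)`, where `t = 1`
  have h3 := symmetrize_curvComp_canonical (r := -1) (s := 0) (t := 1) hg hU he hp h_levi h_chern
    h_bismut (by norm_num) i j k l
  rw [canonical_neg_one_zero] at h3
  refine ⟨curvComp_canonical hg hU he hp h_levi h_chern h_bismut ht i j k l, h2, ?_⟩
  push_cast at h3
  linear_combination h2 - h3
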